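/- Let $d\ge 1$, let $\beta\ge 0$, and let $(J_{x,y})_{x,y\in\mathbb Z^d}$ be real coupling constants, $J_{x,y}=J_{y,x}$, which satisfy **C1** $J_{x,y}=J_{0,y-x}$; **C2** $J_{x,y}\ge 0$; **C3** $\sum_{x\in\mathbb Z^d}J_{0,x}<\infty$; **C4** for every $x\in\mathbb Z^d$ there are $0=x_0,x_1,\dots,x_m=x$ in $\mathbb Z^d$ with $J_{x_0,x_1}J_{x_1,x_2}\cdots J_{x_{m-1},x_m}>0$. For finite $\Lambda\subset\mathbb Z^d$ and $\tau\in\{-1,0,1\}^{\mathbb Z^d\setminus\Lambda}$ let $\langle\cdot\rangle^{\tau}_{\Lambda,\beta}$ be the Gibbs state on $\{-1,1\}^\Lambda$ with weights proportional to $e^{-\beta H^\tau_\Lambda(\sigma)}$, where $$H^\tau_\Lambda(\sigma)=-\sum_{\{x,y\}\subset\Lambda,\,x\ne y}J_{x,y}\sigma_x\sigma_y-\sum_{x\in\Lambda,\,y\notin\Lambda}J_{x,y}\sigma_x\tau_y .$$ There are unique probability measures $\langle\cdot\rangle^+_\beta$ (plus state) and $\langle\cdot\rangle^0_\beta$ (free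 state) on $\{-1,1\}^{\mathbb Z^d}$ such that, for every local function $f$ (one which depends on finitely many spins), $\langle f\rangle^{\tau}_{\Lambda,\beta}$ converges, as $\Lambda\uparrow\mathbb Z^d$ through the finite subsets ordered by inclusion, to $\langle f\rangle^+_\beta$ when $\tau\equiv 1$ and to $\langle f\rangle^0_\beta$ when $\tau\equiv 0$. Write $(\tau_x\sigma)_y=\sigma_{y+x}$ for the translations. Then: 1. The plus state is mixing and ergodic: for all local functions $F,G:\{-1,1\}^{\mathbb Z^d}\to\mathbb R$, $$\lim_{\|x\|\to\infty}\langle F\times G\circ\tau_x\rangle^+_\beta=\langle F\rangle^+_\beta\,\langle G\rangle^+_\beta ;$$ for all measurable events $A,B$ the probability of $A\cap\tau_x^{-1}B$ tends to the product of the probabilities of $A$ and $B$ as $\|x\|\to\infty$; and the state is translation invariant and gives probability $0$ or $1$ to every translation invariant event. 2. The free state is mixing and ergodic in its restriction to the $\sigma$-algebra of even events, that is, of the measurable events invariant under the global spin flip $\sigma\mapsto-\sigma$: for all local functions $F,G$ with $F(-\sigma)=F(\sigma)$ and $G(-\sigma)=G(\sigma)$, $$\lim_{\|x\|\to\infty}\langle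 F\times G\circ\tau_x\rangle^0_\beta=\langle F\rangle^0_\beta\,\langle G\rangle^0_\beta ;$$ for all even events $A,B$ the probability of $A\cap\tau_x^{-1}B$ tends to the product of the probabilities of $A$ and $B$ as $\|x\|\to\infty$; and the state is translation invariant and gives probability $0$ or $1$ to every translation invariant even event. -/

import Mathlib

open Filter Topology MeasureTheory

/-- The lattice `ℤ^d`. -/
abbrev Site (d : ℕ) : Type := Fin d → ℤ

/-- Spin configurations `σ ∈ {-1, 1}^{ℤ^d}`, with the product σ-algebra; `ℤˣ = {1, -1}`. -/
abbrev Config (d : ℕ) : Type := Site d → ℤˣ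

/-- The real value `±1` of a spin. -/
def spin (s : ℤˣ) : ℝ := ((s : ℤ) : ℝ)

/-- The standing conditions on the coupling constants. The coupling constants belong to unordered
pairs of sites, which is recorded by `symm`. -/
structure IsFerromagnetic {d : ℕ} (J : Site d → Site d → ℝ) : Prop where
  symm : ∀ x y, J x y = J y x
  translation_invariant : ∀ x y, J x y = J 0 (y - x)
  nonneg : ∀ x y, 0 ≤ J x y
  locally_finite : Summable fun x => J 0 x
  aperiodic : ∀ x, ∃ (m : ℕ) (p : ℕ → Site d), p 0 = 0 ∧ p m = x ∧
    0 < ∏ i ∈ Finset.range m, J (p i) (p (i + 1))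

/-- The Hamiltonian in the finite volume `Λ`, with magnetic field `h` and boundary condition
`τ ∈ {-1, 0, 1}`, of which only the values outside `Λ` are used. The second sum runs over ordered
pairs of distinct sites of `Λ`, so the factor `1/2` counts every unordered pair once. -/
noncomputable def hamiltonian {d : ℕ} (J : Site d → Site d → ℝ) (h : ℝ) (τ : Site d → SignType)
    (Λ : Finset (Site d)) (σ : Λ → ℤˣ) : ℝ :=
  - (∑ x : Λ, h * spin (σ x))
  - (1 / 2) * (∑ x : Λ, ∑ y : Λ, if x ≠ y then J x y * spin (σ x) * spin (σ y) else 0)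
  - ∑ x : Λ, ∑' y : {y : Site d // y ∉ Λ}, J x y * spin (σ x) * ((τ y : SignType) : ℝ)

/-- Extension of a configuration in `Λ` to the whole lattice by the value `1`. It serves only to
evaluate functions on `Config d`; it is immaterial for functions of the spins in `Λ`. -/
def extend {d : ℕ} (Λ : Finset (Site d)) (σ : Λ → ℤˣ) : Config d :=
  fun x => if hx : x ∈ Λ then σ ⟨x, hx⟩ else 1

/-- The partition function. -/
noncomputable def partitionFunction {d : ℕ} (J : Site d → Site d → ℝ) (β h : ℝ)
    (τ : Site d → SignType) (Λ : Finset (Site d)) : ℝ :=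
  ∑ σ : Λ → ℤˣ, Real.exp (-β * hamiltonian J h τ Λ σ)

/-- The expectation of `f` in the finite volume Gibbs state in `Λ`. -/
noncomputable def finiteGibbs {d : ℕ} (J : Site d → Site d → ℝ) (β h : ℝ)
    (τ : Site d → SignType) (Λ : Finset (Site d)) (f : Config d → ℝ) : ℝ :=
  ∑ σ : Λ → ℤˣ, f (extend Λ σ) *
    (Real.exp (-β * hamiltonian J h τ Λ σ) / partitionFunction J β h τ Λ)

/-- Local functions: those which depend on finitely many spins. -/
def IsLocal {d : ℕ} (f : Config d → ℝ) : Prop :=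
  ∃ A : Finset (Site d), DependsOn f (A : Set (Site d))

/-- `μ` is the infinite volume limit of the finite volume Gibbs states with boundary condition `τ`:
as `Λ` increases to the whole lattice through its finite subsets, the expectations of local
functions converge to those under `μ`. -/
def IsInfiniteVolumeState {d : ℕ} (J : Site d → Site d → ℝ) (β h : ℝ) (τ : Site d → SignType)
    (μ : ProbabilityMeasure (Config d)) : Prop :=
  ∀ f : Config d → ℝ, IsLocal f →
    Tendsto (fun Λ : Finset (Site d) => finiteGibbs J β h τ Λ f) atTop
      (𝓝 (∫ σ, f σ ∂(μ : Measure (Config d))))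

/-- The state with plus boundary conditions, at zero magnetic field. -/
def IsPlusState {d : ℕ} (J : Site d → Site d → ℝ) (β : ℝ)
    (μ : ProbabilityMeasure (Config d)) : Prop :=
  IsInfiniteVolumeState J β 0 (fun _ => 1) μ

/-- The state with free boundary conditions, at zero magnetic field. -/
def IsFreeState {d : ℕ} (J : Site d → Site d → ℝ) (β : ℝ)
    (μ : ProbabilityMeasure (Config d)) : Prop :=
  IsInfiniteVolumeState J β 0 (fun _ => 0) μ

/-- The translation `(τ_x σ)_y = σ_{y + x}`. -/
def shift {d : ℕ} (x : Site d) (σ : Config d) : Config d := fun y => σ (y + x)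

/-- The filter `‖x‖ → ∞` on `ℤ^d`. -/
def atInfinity (d : ℕ) : Filter (Site d) := comap (fun x : Site d => ‖x‖) atTop

/-- Even functions: invariant under the global spin flip. -/
def IsEven {d : ℕ} (F : Config d → ℝ) : Prop := ∀ σ, F (-σ) = F σ

/-- The σ-algebra of even events: measurable sets invariant under the global spin flip. -/
def evenEvents (d : ℕ) : Set (Set (Config d)) :=
  {A | MeasurableSet[MeasurableSpace.invariants (fun σ : Config d => -σ)] A}

/-- `⟨F × G ∘ τ_x⟩ → ⟨F⟩ ⟨G⟩` as `‖x‖ → ∞`, for all `F` and `G` in the class `C`. -/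
def IsMixingFor {d : ℕ} (μ : ProbabilityMeasure (Config d)) (C : Set (Config d → ℝ)) : Prop :=
  ∀ F ∈ C, ∀ G ∈ C,
    Tendsto (fun x : Site d => ∫ σ, F σ * G (shift x σ) ∂(μ : Measure (Config d))) (atInfinity d)
      (𝓝 ((∫ σ, F σ ∂(μ : Measure (Config d))) * ∫ σ, G σ ∂(μ : Measure (Config d))))

/-- Mixing on a family `𝒜` of events: `μ (A ∩ τ_x⁻¹ B) → μ A * μ B` as `‖x‖ → ∞`, for `A` and `B`
in `𝒜`. -/
def IsMixingOn {d : ℕ} (μ : ProbabilityMeasure (Config d)) (𝒜 : Set (Set (Config d))) : Prop :=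
  ∀ A ∈ 𝒜, ∀ B ∈ 𝒜,
    Tendsto (fun x : Site d => (μ : Measure (Config d)) (A ∩ shift x ⁻¹' B)) (atInfinity d)
      (𝓝 ((μ : Measure (Config d)) A * (μ : Measure (Config d)) B))

/-- Ergodicity on a family `𝒜` of events: `μ` is translation invariant, and the events of `𝒜` which
are invariant under all translations have probability `0` or `1`. -/
def IsErgodicOn {d : ℕ} (μ : ProbabilityMeasure (Config d)) (𝒜 : Set (Set (Config d))) : Prop :=
  (∀ x : Site d, MeasurePreserving (shift x) (μ : Measure (Config d)) (μ : Measure (Config d))) ∧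
  ∀ A ∈ 𝒜, (∀ x : Site d, shift x ⁻¹' A = A) →
    (μ : Measure (Config d)) A = 0 ∨ (μ : Measure (Config d)) A = 1

/-! Everything rests on the second Griffiths inequality, `griffiths_second`. It makes expectations
of functions in the cone decrease with the volume under plus boundary conditions and increase under
free ones, so the limits of all characters exist, and compactness turns them into measures.
Translated volumes are cofinal among finite volumes, whence translation invariance.

For mixing, it suffices to treat a family that spans the local functions (for the free state, the
even ones) and admits bounds on both sides. From below, `⟨F · G ∘ τ_x⟩ ≥ ⟨F⟩⟨G⟩` is positive
correlation. From above, `⟨F · G ∘ τ_x⟩_Λ ≤ ⟨F⟩_Λ ⟨G⟩_V` as soon as the translate of `V` by `x`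
avoids the support of `F`. Letting `Λ`, then `x`, then `V` grow closes the gap
(`isMixingFor_of_bounds`).

In the plus state the family consists of the products of `1 + σ_x`: freezing every spin outside the
translate of `V` to `1` can only raise the mean of `G ∘ τ_x`, and leaves the plus state there
(`plus_gibbs_le`). In the free state it consists of the inverse Boltzmann factors `removal` of
finite sets of bonds. Their means are ratios of partition functions, and both bounds are cases of
the log-supermodularity of the partition function in the set of bonds
(`avg_bondWeight_supermodular`). Because `exp (-k σ_p) = cosh k - sinh k σ_p`, these factors
generate `σ_x σ_y` along every bond of positive coupling, hence by connectivity all even characters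
when `β > 0`.

Events are then approximated in `L¹` by local functions, and an invariant event satisfies `μ A = μ A
* μ A`. -/

/-! ### Griffiths' inequalities on commutative groups -/

/-- The cone of nonnegative combinations of characters with values `±1`. -/
def posCone (G : Type*) [CommGroup G] : AddSubmonoid (G → ℝ) :=
  AddSubmonoid.closure {f | ∃ c : ℝ, 0 ≤ c ∧ ∃ χ : G →* ℤˣ, f = fun σ => c * spin (χ σ)}

/-- The weights for which the second Griffiths inequality holds. -/
def IsFerroWeight {G : Type*} [CommGroup G] (w : G → ℝ) : Prop :=
  ∀ t, (fun σ => w σ * w (σ * t)) ∈ posCone G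

lemma spin_mul (a b : ℤˣ) : spin (a * b) = spin a * spin b := by simp [spin]

lemma spin_one : spin 1 = 1 := by simp [spin]

lemma spin_neg (a : ℤˣ) : spin (-a) = -spin a := by simp [spin]

lemma spin_eq_or (a : ℤˣ) : spin a = 1 ∨ spin a = -1 := by
  rcases Int.units_eq_one_or a with rfl | rfl <;> simp [spin]

lemma spin_mul_self (a : ℤˣ) : spin a * spin a = 1 := by
  rcases spin_eq_or a with h | h <;> simp [h]

lemma spin_le_one (a : ℤˣ) : spin a ≤ 1 := by
  rcases spin_eq_or a with h | h <;> simp [h]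

lemma neg_one_le_spin (a : ℤˣ) : -1 ≤ spin a := by
  rcases spin_eq_or a with h | h <;> simp [h]

lemma exp_mul_spin (k : ℝ) (a : ℤˣ) :
    Real.exp (k * spin a) = Real.cosh k + Real.sinh k * spin a := by
  rcases spin_eq_or a with h | h
  · simp [h]
  · simp [h, ← sub_eq_add_neg]

section Cone

variable {G : Type*} [CommGroup G]

lemma mem_posCone_of_char {c : ℝ} (hc : 0 ≤ c) (χ : G →* ℤˣ) :
    (fun σ => c * spin (χ σ)) ∈ posCone G :=
  AddSubmonoid.subset_closure ⟨c, hc, χ, rfl⟩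

lemma char_mem_posCone (χ : G →* ℤˣ) : (fun σ => spin (χ σ)) ∈ posCone G := by
  simpa using mem_posCone_of_char zero_le_one χ

lemma const_mem_posCone {c : ℝ} (hc : 0 ≤ c) : (fun _ => c) ∈ posCone G := by
  simpa [spin_one] using mem_posCone_of_char hc (1 : G →* ℤˣ)

lemma add_mem_posCone {f g : G → ℝ} (hf : f ∈ posCone G) (hg : g ∈ posCone G) :
    (fun σ => f σ + g σ) ∈ posCone G :=
  add_mem hf hg

lemma mul_mem_posCone {f g : G → ℝ} (hf : f ∈ posCone G) (hg : g ∈ posCone G) :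
    (fun σ => f σ * g σ) ∈ posCone G := by
  change f * g ∈ posCone G
  induction hf using AddSubmonoid.closure_induction with
  | zero => simp [(posCone G).zero_mem]
  | add x y _ _ hx hy => rw [add_mul]; exact add_mem hx hy
  | mem x hx =>
    obtain ⟨c, hc, χ, rfl⟩ := hx
    induction hg using AddSubmonoid.closure_induction with
    | zero => simp [(posCone G).zero_mem]
    | add x y _ _ hx hy => rw [mul_add]; exact add_mem hx hy
    | mem y hy =>
      obtain ⟨c', hc', χ', rfl⟩ := hy
      convert mem_posCone_of_char (mul_nonneg hc hc') (χ * χ') using 1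
      ext σ
      simp [spin_mul]
      ring

lemma prod_mem_posCone {ι : Type*} (s : Finset ι) {f : ι → G → ℝ}
    (hf : ∀ i ∈ s, f i ∈ posCone G) : (fun σ => ∏ i ∈ s, f i σ) ∈ posCone G := by
  classical
  induction s using Finset.induction_on with
  | empty => simpa using const_mem_posCone zero_le_one
  | insert a s ha ih =>
    simp only [Finset.prod_insert ha]
    exact mul_mem_posCone (hf a (by simp)) (ih fun i hi => hf i (by simp [hi]))

lemma one_add_char_mem_posCone (χ : G →* ℤˣ) : (fun σ => 1 + spin (χ σ)) ∈ posCone G :=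
  add_mem_posCone (const_mem_posCone zero_le_one) (char_mem_posCone χ)

lemma exp_char_mem_posCone {k : ℝ} (hk : 0 ≤ k) (χ : G →* ℤˣ) :
    (fun σ => Real.exp (k * spin (χ σ))) ∈ posCone G := by
  simp only [exp_mul_spin]
  exact add_mem_posCone (const_mem_posCone (Real.cosh_pos k).le)
    (mem_posCone_of_char (Real.sinh_nonneg_iff.2 hk) χ)

lemma exp_sum_mem_posCone {ι : Type*} (s : Finset ι) {k : ι → ℝ} (hk : ∀ i ∈ s, 0 ≤ k i)
    (χ : ι → G →* ℤˣ) : (fun σ => Real.exp (∑ i ∈ s, k i * spin (χ i σ))) ∈ posCone G := by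
  simp only [Real.exp_sum]
  exact prod_mem_posCone s fun i hi => exp_char_mem_posCone (hk i hi) (χ i)

lemma IsFerroWeight.one : IsFerroWeight (fun _ : G => 1) := fun _ => by
  simpa using const_mem_posCone zero_le_one

lemma IsFerroWeight.mul {w w' : G → ℝ} (hw : IsFerroWeight w) (hw' : IsFerroWeight w') :
    IsFerroWeight (fun σ => w σ * w' σ) := fun t => by
  convert mul_mem_posCone (hw t) (hw' t) using 1
  ext σ
  ring

lemma IsFerroWeight.prod {ι : Type*} (s : Finset ι) {w : ι → G → ℝ}
    (hw : ∀ i ∈ s, IsFerroWeight (w i)) : IsFerroWeight (fun σ => ∏ i ∈ s, w i σ) := by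
  classical
  induction s using Finset.induction_on with
  | empty => simpa using IsFerroWeight.one
  | insert a s ha ih =>
    simp only [Finset.prod_insert ha]
    exact (hw a (by simp)).mul (ih fun i hi => hw i (by simp [hi]))

/-- The two copies multiply to `exp (k (1 + χ t) χ σ)`, and `1 + χ t` is `0` or `2`. -/
lemma isFerroWeight_exp_char {k : ℝ} (hk : 0 ≤ k) (χ : G →* ℤˣ) :
    IsFerroWeight (fun σ => Real.exp (k * spin (χ σ))) := fun t => by
  have h : 0 ≤ k * (1 + spin (χ t)) := mul_nonneg hk (by linarith [neg_one_le_spin (χ t)])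
  convert exp_char_mem_posCone h χ using 1
  ext σ
  rw [← Real.exp_add, map_mul, spin_mul]
  ring_nf

lemma isFerroWeight_exp_sum {ι : Type*} (s : Finset ι) {k : ι → ℝ} (hk : ∀ i ∈ s, 0 ≤ k i)
    (χ : ι → G →* ℤˣ) : IsFerroWeight (fun σ => Real.exp (∑ i ∈ s, k i * spin (χ i σ))) := by
  simp only [Real.exp_sum]
  exact IsFerroWeight.prod s fun i hi => isFerroWeight_exp_char (hk i hi) (χ i)

/-- The two copies multiply to `(1 + χ)²` or to `1 - χ² = 0`. Hard conditioning on `χ = 1` is thus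
admissible in Griffiths' inequality, like an infinite field. -/
lemma isFerroWeight_one_add_char (χ : G →* ℤˣ) : IsFerroWeight (fun σ => 1 + spin (χ σ)) := by
  intro t
  simp only [map_mul, spin_mul]
  rcases spin_eq_or (χ t) with h | h
  · simp only [h, mul_one]
    exact mul_mem_posCone (one_add_char_mem_posCone χ) (one_add_char_mem_posCone χ)
  · convert (posCone G).zero_mem using 1
    ext σ
    have := spin_mul_self (χ σ)
    simp only [h, Pi.zero_apply]
    linarith

/-! ### The two Griffiths inequalities -/

variable {H : Type*} [CommGroup H] [Fintype H] (φ : H →* G)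

/-- Translation by an element where `χ = -1` negates the sum, so it vanishes unless `χ` is trivial.
-/
lemma sum_spin_char_nonneg (χ : H →* ℤˣ) : 0 ≤ ∑ h, spin (χ h) := by
  by_cases hχ : ∃ g, spin (χ g) = -1
  · obtain ⟨g, hg⟩ := hχ
    have : ∑ h, spin (χ h) = ∑ h, spin (χ (g * h)) :=
      (Fintype.sum_equiv (Equiv.mulLeft g) _ _ fun _ => rfl).symm
    simp only [map_mul, spin_mul, hg, neg_one_mul, Finset.sum_neg_distrib] at this
    linarith
  · push Not at hχ
    exact Finset.sum_nonneg fun h _ => by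
      rcases spin_eq_or (χ h) with h' | h'
      · simp [h']
      · exact absurd h' (hχ h)

/-- The first Griffiths inequality. -/
lemma sum_nonneg_of_mem_posCone {f : G → ℝ} (hf : f ∈ posCone G) : 0 ≤ ∑ h, f (φ h) := by
  induction hf using AddSubmonoid.closure_induction with
  | zero => simp
  | add x y _ _ hx hy => simpa [Finset.sum_add_distrib] using add_nonneg hx hy
  | mem x hx =>
    obtain ⟨c, hc, χ, rfl⟩ := hx
    rw [← Finset.mul_sum]
    exact mul_nonneg hc (sum_spin_char_nonneg (χ.comp φ))

/-- The second Griffiths inequality, by duplication of the variables. -/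
lemma griffiths_second {f g w : G → ℝ} (hf : f ∈ posCone G) (hg : g ∈ posCone G)
    (hw : IsFerroWeight w) :
    (∑ h, f (φ h) * w (φ h)) * (∑ h, g (φ h) * w (φ h)) ≤
      (∑ h, f (φ h) * g (φ h) * w (φ h)) * ∑ h, w (φ h) := by
  induction hg using AddSubmonoid.closure_induction with
  | zero => simp
  | add x y _ _ hx hy =>
    simp only [Pi.add_apply, add_mul, mul_add, Finset.sum_add_distrib]
    linarith
  | mem x hx =>
    obtain ⟨c, hc, χ, rfl⟩ := hx
    rw [← sub_nonneg]
    -- The second copy of the spins is written as `h * t`. The character then contributes the factor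
    -- `1 - χ t ≥ 0`, and for fixed `t` the sum over `h` falls under the first inequality.
    have key : (∑ h, f (φ h) * (c * spin (χ (φ h))) * w (φ h)) * (∑ h, w (φ h)) -
        (∑ h, f (φ h) * w (φ h)) * (∑ h, c * spin (χ (φ h)) * w (φ h)) =
        ∑ t, c * (1 - spin (χ (φ t))) *
          ∑ h, f (φ h) * spin (χ (φ h)) * (w (φ h) * w (φ h * φ t)) := by
      simp_rw [Finset.sum_mul_sum, ← Finset.sum_sub_distrib, Finset.mul_sum]
      conv_rhs => rw [Finset.sum_comm]
      refine Finset.sum_congr rfl fun h _ => ?_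
      rw [← Equiv.sum_comp (Equiv.mulLeft h)]
      refine Finset.sum_congr rfl fun t _ => ?_
      simp only [Equiv.coe_mulLeft, map_mul, spin_mul]
      ring
    rw [key]
    refine Finset.sum_nonneg fun t _ => mul_nonneg
      (mul_nonneg hc (by linarith [spin_le_one (χ (φ t))])) ?_
    exact sum_nonneg_of_mem_posCone φ (f := fun σ => f σ * spin (χ σ) * (w σ * w (σ * φ t)))
      (mul_mem_posCone (mul_mem_posCone hf (char_mem_posCone χ)) (hw (φ t)))

end Cone

/-! ### Spin characters and local functions -/

section Local

variable {d : ℕ}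

/-- The character `σ ↦ ∏_{x ∈ A} σ_x`. -/
def spinChar (A : Finset (Site d)) : Config d →* ℤˣ :=
  ∏ x ∈ A, Pi.evalMonoidHom (fun _ : Site d => ℤˣ) x

/-- The real-valued function `σ_A = ∏_{x ∈ A} σ_x`. -/
def spinProd (A : Finset (Site d)) (σ : Config d) : ℝ := spin (spinChar A σ)

/-- Extension by `1` as a homomorphism. -/
def extendHom (Λ : Finset (Site d)) : (Λ → ℤˣ) →* Config d where
  toFun := extend Λ
  map_one' := by ext x; simp [_root_.extend]
  map_mul' σ τ := by
    ext x
    by_cases hx : x ∈ Λ <;> simp [_root_.extend, hx]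

lemma extendHom_apply (Λ : Finset (Site d)) (σ : Λ → ℤˣ) : extendHom Λ σ = extend Λ σ := rfl

lemma extend_apply_mem {Λ : Finset (Site d)} (σ : Λ → ℤˣ) {x : Site d} (hx : x ∈ Λ) :
    extend Λ σ x = σ ⟨x, hx⟩ := by simp [_root_.extend, hx]

lemma spinChar_apply (A : Finset (Site d)) (σ : Config d) : spinChar A σ = ∏ x ∈ A, σ x := by
  simp [spinChar, MonoidHom.finsetProd_apply]

lemma spin_prod {ι : Type*} (s : Finset ι) (f : ι → ℤˣ) :
    spin (∏ i ∈ s, f i) = ∏ i ∈ s, spin (f i) := by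
  simp [spin]

lemma spinProd_apply (A : Finset (Site d)) (σ : Config d) :
    spinProd A σ = ∏ x ∈ A, spin (σ x) := by
  rw [spinProd, spinChar_apply, spin_prod]

lemma spinProd_empty : spinProd (∅ : Finset (Site d)) = fun _ => 1 := by
  ext σ
  simp [spinProd_apply]

lemma spinProd_union {A B : Finset (Site d)} (h : Disjoint A B) (σ : Config d) :
    spinProd (A ∪ B) σ = spinProd A σ * spinProd B σ := by
  simp only [spinProd_apply, Finset.prod_union h]

lemma dependsOn_spinProd (A : Finset (Site d)) : DependsOn (spinProd A) (A : Set (Site d)) := by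
  intro σ τ h
  simp only [spinProd_apply]
  exact Finset.prod_congr rfl fun x hx => by rw [h x hx]

/-- The span of the characters supported in `A`. -/
def spinSpan (A : Finset (Site d)) : Submodule ℝ (Config d → ℝ) :=
  Submodule.span ℝ (spinProd '' {B | B ⊆ A})

lemma spinSpan_mono {A B : Finset (Site d)} (h : A ⊆ B) : spinSpan A ≤ spinSpan B :=
  Submodule.span_mono (Set.image_mono fun _ hC => Finset.Subset.trans hC h)

lemma mul_spin_mem_spinSpan {A : Finset (Site d)} {a : Site d} (ha : a ∉ A) {f : Config d → ℝ}
    (hf : f ∈ spinSpan A) : (fun σ => f σ * spin (σ a)) ∈ spinSpan (insert a A) := by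
  induction hf using Submodule.span_induction with
  | mem x hx =>
    obtain ⟨B, hB, rfl⟩ := hx
    refine Submodule.subset_span ⟨insert a B, Finset.insert_subset_insert a hB, ?_⟩
    ext σ
    rw [spinProd_apply, spinProd_apply, Finset.prod_insert fun h => ha (hB h), mul_comm]
  | zero =>
    convert (spinSpan (insert a A)).zero_mem using 1
    ext σ
    simp
  | add x y _ _ hx hy =>
    convert add_mem hx hy using 1
    ext σ
    simp [add_mul]
  | smul c x _ hx =>
    have := (spinSpan (insert a A)).smul_mem c hx
    convert this using 1
    ext σ
    simp [mul_assoc]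

/-- A function of the spins in `A` is a linear combination of characters. -/
lemma DependsOn.mem_spinSpan {A : Finset (Site d)} {f : Config d → ℝ}
    (hf : DependsOn f (A : Set (Site d))) : f ∈ spinSpan A := by
  classical
  induction A using Finset.induction_on generalizing f with
  | empty =>
    have : f = f 1 • spinProd ∅ := by
      ext σ
      simpa [spinProd_empty] using hf (by simp)
    rw [this]
    exact Submodule.smul_mem _ _ (Submodule.subset_span ⟨∅, by simp, rfl⟩)
  | insert a A ha ih =>
    have key : ∀ s : ℤˣ, (fun σ => f (Function.update σ a s)) ∈ spinSpan A := by
      refine fun s => ih fun σ τ h => hf fun x hx => ?_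
      by_cases hxa : x = a
      · simp [hxa]
      · have : x ∈ A := by simpa [hxa] using hx
        simpa [hxa] using h x (by simpa using this)
    have hsub : spinSpan A ≤ spinSpan (insert a A) := spinSpan_mono (Finset.subset_insert a A)
    have h1 := (add_mem (hsub (key 1)) (hsub (key (-1))))
    have h2 := (sub_mem (mul_spin_mem_spinSpan ha (key 1)) (mul_spin_mem_spinSpan ha (key (-1))))
    -- With `f₊`, `f₋` the values of `f` at `σ_a = 1`, `-1`: `f = ((f₊ + f₋) + (f₊ - f₋) σ_a) / 2`.
    convert (spinSpan (insert a A)).smul_mem (1 / 2 : ℝ) (add_mem h1 h2) using 1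
    ext σ
    rcases Int.units_eq_one_or (σ a) with h | h
    · have : Function.update σ a 1 = σ := by rw [← h, Function.update_eq_self]
      simp [this, h, spin]
      ring
    · have : Function.update σ a (-1) = σ := by rw [← h, Function.update_eq_self]
      simp [this, h, spin]
      ring

lemma DependsOn.mul' {f g : Config d → ℝ} {A : Set (Site d)} (hf : DependsOn f A)
    (hg : DependsOn g A) : DependsOn (fun σ => f σ * g σ) A := fun σ τ h => by
  simp only [hf h, hg h]

lemma IsLocal.mem_span {f : Config d → ℝ} (hf : IsLocal f) :
    f ∈ Submodule.span ℝ (Set.range (spinProd (d := d))) := by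
  obtain ⟨A, hA⟩ := hf
  exact Submodule.span_mono (Set.image_subset_range _ _) hA.mem_spinSpan

lemma IsLocal.comp₂ {f g : Config d → ℝ} (hf : IsLocal f) (hg : IsLocal g) (φ : ℝ → ℝ → ℝ) :
    IsLocal (fun σ => φ (f σ) (g σ)) := by
  classical
  obtain ⟨A, hA⟩ := hf
  obtain ⟨B, hB⟩ := hg
  refine ⟨A ∪ B, fun σ τ h => ?_⟩
  simp only
  rw [hA fun x hx => h x (by simp [Finset.mem_coe.1 hx]),
    hB fun x hx => h x (by simp [Finset.mem_coe.1 hx])]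

/-- The translateSites of a finite set of sites. -/
def translateSites (x : Site d) (A : Finset (Site d)) : Finset (Site d) :=
  A.map (addRightEmbedding x)

lemma mem_translateSites {x y : Site d} {A : Finset (Site d)} : y ∈ translateSites x A ↔ y - x ∈ A := by
  simp [translateSites, addRightEmbedding, ← eq_sub_iff_add_eq]

lemma translateSites_mono (x : Site d) {A B : Finset (Site d)} (h : A ⊆ B) :
    translateSites x A ⊆ translateSites x B :=
  Finset.map_subset_map.2 h

lemma DependsOn.shift {f : Config d → ℝ} {A : Finset (Site d)}
    (hf : DependsOn f (A : Set (Site d))) (x : Site d) :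
    DependsOn (fun σ => f (shift x σ)) (translateSites x A : Set (Site d)) := fun σ τ h =>
  hf fun y hy => h (y + x) (by simpa [mem_translateSites] using hy)

lemma IsLocal.shift {f : Config d → ℝ} (hf : IsLocal f) (x : Site d) :
    IsLocal (fun σ => f (shift x σ)) :=
  let ⟨A, hA⟩ := hf
  ⟨translateSites x A, hA.shift x⟩

lemma spinProd_shift (x : Site d) (A : Finset (Site d)) (σ : Config d) :
    spinProd A (shift x σ) = spinProd (translateSites x A) σ := by
  simp [spinProd_apply, translateSites, shift, Finset.prod_map]

lemma spinProd_neg (A : Finset (Site d)) (σ : Config d) :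
    spinProd A (-σ) = (-1) ^ A.card * spinProd A σ := by
  simp [spinProd_apply, spin_neg, Finset.prod_neg]

end Local

/-! ### Averages over the spins in a finite set -/

section Avg

variable {d : ℕ}

/-- The average of `f` over the uniformly distributed spins in `Λ`. -/
noncomputable def avg (Λ : Finset (Site d)) : (Config d → ℝ) →ₗ[ℝ] ℝ where
  toFun f := (∑ σ : Λ → ℤˣ, f (extend Λ σ)) / 2 ^ Λ.card
  map_add' f g := by simp [Finset.sum_add_distrib, add_div]
  map_smul' c f := by simp [← Finset.mul_sum, mul_div_assoc]

lemma avg_apply (Λ : Finset (Site d)) (f : Config d → ℝ) :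
    avg Λ f = (∑ σ : Λ → ℤˣ, f (extend Λ σ)) / 2 ^ Λ.card := rfl

lemma avg_const (Λ : Finset (Site d)) (c : ℝ) : avg Λ (fun _ => c) = c := by
  rw [avg_apply]
  simp [Fintype.card_units_int]

lemma avg_mul_const (Λ : Finset (Site d)) (f : Config d → ℝ) (c : ℝ) :
    avg Λ (fun σ => c * f σ) = c * avg Λ f :=
  (avg Λ).map_smul c f

lemma avg_pos (Λ : Finset (Site d)) {f : Config d → ℝ} (hf : ∀ σ, 0 < f σ) : 0 < avg Λ f :=
  div_pos (Finset.sum_pos (fun _ _ => hf _) ⟨1, Finset.mem_univ _⟩) (by positivity)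

lemma avg_mono (Λ : Finset (Site d)) {f g : Config d → ℝ} (h : ∀ σ, f σ ≤ g σ) :
    avg Λ f ≤ avg Λ g := by
  rw [avg_apply, avg_apply]
  gcongr
  exact h _

lemma avg_griffiths (Λ : Finset (Site d)) {f g w : Config d → ℝ} (hf : f ∈ posCone (Config d))
    (hg : g ∈ posCone (Config d)) (hw : IsFerroWeight w) :
    avg Λ (fun σ => f σ * w σ) * avg Λ (fun σ => g σ * w σ) ≤
      avg Λ (fun σ => f σ * g σ * w σ) * avg Λ w := by
  simp only [avg_apply, div_mul_div_comm]
  exact div_le_div_of_nonneg_right (griffiths_second (extendHom Λ) hf hg hw) (by positivity)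

/-- Averages of local functions are determined by this value, in which `Λ` plays no role.
Independence of the volume, invariance under shift and flip, and factorization over disjoint sets
are all checked on characters. -/
lemma avg_spinProd {Λ A : Finset (Site d)} (h : A ⊆ Λ) :
    avg Λ (spinProd A) = if A = ∅ then 1 else 0 := by
  classical
  split_ifs with hA
  · rw [hA, spinProd_empty, avg_const]
  · obtain ⟨a, ha⟩ := Finset.nonempty_iff_ne_empty.2 hA
    rw [avg_apply, div_eq_zero_iff]
    left
    -- Multiplication by `g` flips a single spin of `A`, which reverses the sign of `spinProd A`.
    let g : Λ → ℤˣ := Function.update 1 ⟨a, h ha⟩ (-1)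
    have hg : spinProd A (extend Λ g) = -1 := by
      rw [spinProd_apply, Finset.prod_eq_single a]
      · simp [extend_apply_mem _ (h ha), g, spin]
      · intro b hb hba
        simp [extend_apply_mem _ (h hb), g, spin, hba]
      · exact fun h => absurd ha h
    have key : ∑ σ, spinProd A (extend Λ σ) = ∑ σ, spinProd A (extend Λ (g * σ)) :=
      (Equiv.sum_comp (Equiv.mulLeft g) fun σ => spinProd A (extend Λ σ)).symm
    have hmul : ∀ σ, spinProd A (extend Λ (g * σ)) = -spinProd A (extend Λ σ) := by
      intro σ
      rw [← extendHom_apply, map_mul, spinProd, map_mul, spin_mul, extendHom_apply,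
        extendHom_apply]
      change spinProd A (extend Λ g) * spinProd A (extend Λ σ) = _
      rw [hg, neg_one_mul]
    simp only [hmul, Finset.sum_neg_distrib] at key
    linarith

lemma avg_congr {Λ Λ' A : Finset (Site d)} (h : A ⊆ Λ) (h' : A ⊆ Λ') {f : Config d → ℝ}
    (hf : DependsOn f (A : Set (Site d))) : avg Λ f = avg Λ' f := by
  refine LinearMap.eqOn_span (s := spinProd '' {B | B ⊆ A}) ?_ hf.mem_spinSpan
  rintro _ ⟨B, hB, rfl⟩
  rw [avg_spinProd (hB.trans h), avg_spinProd (hB.trans h')]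

lemma avg_shift {Λ Λ' A : Finset (Site d)} (x : Site d) (h : A ⊆ Λ) (h' : translateSites x A ⊆ Λ')
    {f : Config d → ℝ} (hf : DependsOn f (A : Set (Site d))) :
    avg Λ' (fun σ => f (shift x σ)) = avg Λ f := by
  refine LinearMap.eqOn_span (s := spinProd '' {B | B ⊆ A})
    (f := avg Λ' ∘ₗ LinearMap.funLeft ℝ ℝ (shift x)) ?_ hf.mem_spinSpan
  rintro _ ⟨B, hB, rfl⟩
  have : LinearMap.funLeft ℝ ℝ (shift x) (spinProd B) = spinProd (translateSites x B) := by
    ext σ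
    exact spinProd_shift x B σ
  rw [LinearMap.comp_apply, this, avg_spinProd (hB.trans h),
    avg_spinProd ((translateSites_mono x hB).trans h')]
  simp [translateSites]

lemma avg_neg {Λ A : Finset (Site d)} (h : A ⊆ Λ) {f : Config d → ℝ}
    (hf : DependsOn f (A : Set (Site d))) : avg Λ (fun σ => f (-σ)) = avg Λ f := by
  refine LinearMap.eqOn_span (s := spinProd '' {B | B ⊆ A})
    (f := avg Λ ∘ₗ LinearMap.funLeft ℝ ℝ (fun σ : Config d => -σ)) ?_ hf.mem_spinSpan
  rintro _ ⟨B, hB, rfl⟩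
  have : LinearMap.funLeft ℝ ℝ (fun σ : Config d => -σ) (spinProd B) =
      ((-1) ^ B.card : ℝ) • spinProd B := by
    ext σ
    exact spinProd_neg B σ
  rw [LinearMap.comp_apply, this, map_smul, avg_spinProd (hB.trans h)]
  split_ifs with hB0 <;> simp [hB0]

lemma avg_mul {Λ A B : Finset (Site d)} (hA : A ⊆ Λ) (hB : B ⊆ Λ) (hAB : Disjoint A B)
    {f g : Config d → ℝ} (hf : DependsOn f (A : Set (Site d)))
    (hg : DependsOn g (B : Set (Site d))) :
    avg Λ (fun σ => f σ * g σ) = avg Λ f * avg Λ g := by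
  classical
  have key : ∀ A', A' ⊆ A → avg Λ (fun σ => spinProd A' σ * g σ) = avg Λ (spinProd A') * avg Λ g := by
    intro A' hA'
    refine LinearMap.eqOn_span (s := spinProd '' {B' | B' ⊆ B})
      (f := avg Λ ∘ₗ LinearMap.mulLeft ℝ (spinProd A')) (g := avg Λ (spinProd A') • avg Λ) ?_
      hg.mem_spinSpan
    rintro _ ⟨B', hB', rfl⟩
    have : LinearMap.mulLeft ℝ (spinProd A') (spinProd B') = spinProd (A' ∪ B') := by
      ext σ
      exact (spinProd_union (Finset.disjoint_of_subset_left hA'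
        (Finset.disjoint_of_subset_right hB' hAB)) σ).symm
    rw [LinearMap.comp_apply, this, LinearMap.smul_apply, smul_eq_mul,
      avg_spinProd (Finset.union_subset (hA'.trans hA) (hB'.trans hB)),
      avg_spinProd (hA'.trans hA), avg_spinProd (hB'.trans hB)]
    simp only [Finset.union_eq_empty]
    split_ifs <;> simp_all
  refine LinearMap.eqOn_span (s := spinProd '' {A' | A' ⊆ A})
      (f := avg Λ ∘ₗ LinearMap.mulRight ℝ g) (g := avg Λ g • avg Λ) ?_ hf.mem_spinSpan |>.trans
      (mul_comm _ _)
  rintro _ ⟨A', hA', rfl⟩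
  exact (key A' hA').trans (mul_comm _ _)

end Avg

/-! ### Boltzmann weights -/

section Weights

variable {d : ℕ}

/-- The character `σ ↦ σ_x`. -/
def siteChar (x : Site d) : Config d →* ℤˣ := Pi.evalMonoidHom (fun _ : Site d => ℤˣ) x

/-- The character `σ ↦ σ_x σ_y`. -/
def pairChar (p : Site d × Site d) : Config d →* ℤˣ := siteChar p.1 * siteChar p.2

lemma siteChar_apply (x : Site d) (σ : Config d) : siteChar x σ = σ x := rfl

lemma spin_pairChar (p : Site d × Site d) (σ : Config d) :
    spin (pairChar p σ) = spin (σ p.1) * spin (σ p.2) := by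
  simp [pairChar, siteChar_apply, spin_mul]

/-- The coupling of an ordered pair of sites: half of the coupling of the unordered pair. -/
noncomputable def coupling (J : Site d → Site d → ℝ) (β : ℝ) (p : Site d × Site d) : ℝ :=
  if p.1 ≠ p.2 then β / 2 * J p.1 p.2 else 0

/-- The Boltzmann weight of a set of ordered pairs. -/
noncomputable def bondWeight (J : Site d → Site d → ℝ) (β : ℝ) (S : Finset (Site d × Site d))
    (σ : Config d) : ℝ :=
  Real.exp (∑ p ∈ S, coupling J β p * spin (pairChar p σ))

/-- The field which plus boundary conditions outside `Λ` exert on the spin at `x`. -/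
noncomputable def plusField (J : Site d → Site d → ℝ) (Λ : Finset (Site d)) (x : Site d) : ℝ :=
  (∑' y, J 0 y) - ∑ y ∈ Λ, J x y

/-- The Boltzmann weight in `Λ` with free boundary conditions. -/
noncomputable def freeWeight (J : Site d → Site d → ℝ) (β : ℝ) (Λ : Finset (Site d)) :
    Config d → ℝ :=
  bondWeight J β (Λ ×ˢ Λ)

/-- The Boltzmann weight in `Λ` with plus boundary conditions. -/
noncomputable def plusWeight (J : Site d → Site d → ℝ) (β : ℝ) (Λ : Finset (Site d))
    (σ : Config d) : ℝ :=
  freeWeight J β Λ σ * Real.exp (∑ x ∈ Λ, β * plusField J Λ x * spin (siteChar x σ))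

/-- The properties shared by the weights with free and with plus boundary conditions. -/
structure IsVolumeWeight (w : Finset (Site d) → Config d → ℝ) : Prop where
  pos : ∀ Λ σ, 0 < w Λ σ
  dependsOn : ∀ Λ, DependsOn (w Λ) (Λ : Set (Site d))
  ferro : ∀ Λ, IsFerroWeight (w Λ)
  shift : ∀ x Λ σ, w (translateSites x Λ) σ = w Λ (shift x σ)

/-- The expectation with weight `w Λ` of the spins in `Λ`. -/
noncomputable def gibbs (w : Finset (Site d) → Config d → ℝ) (Λ : Finset (Site d)) :
    (Config d → ℝ) →ₗ[ℝ] ℝ :=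
  (avg Λ (w Λ))⁻¹ • (avg Λ ∘ₗ LinearMap.mulRight ℝ (w Λ))

lemma gibbs_apply (w : Finset (Site d) → Config d → ℝ) (Λ : Finset (Site d)) (f : Config d → ℝ) :
    gibbs w Λ f = avg Λ (fun σ => f σ * w Λ σ) / avg Λ (w Λ) := by
  rw [div_eq_inv_mul]
  rfl

/-! ### The free and plus weights of a ferromagnet -/

section Ferromagnetic

variable {J : Site d → Site d → ℝ} {β : ℝ}

lemma IsFerromagnetic.add_right (hJ : IsFerromagnetic J) (x y z : Site d) :
    J (x + z) (y + z) = J x y := by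
  rw [hJ.translation_invariant, hJ.translation_invariant x y, add_sub_add_right_eq_sub]

lemma IsFerromagnetic.summable (hJ : IsFerromagnetic J) (x : Site d) : Summable (J x) := by
  have := (Equiv.subRight x).summable_iff.2 hJ.locally_finite
  exact this.congr fun y => (hJ.translation_invariant x y).symm

lemma IsFerromagnetic.tsum_eq (hJ : IsFerromagnetic J) (x : Site d) :
    ∑' y, J x y = ∑' y, J 0 y := by
  rw [← (Equiv.subRight x).tsum_eq (J 0)]
  exact tsum_congr fun y => hJ.translation_invariant x y

/-- Writing the boundary field as a total minus a finite sum makes fields of two volumes differ by a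
finite sum; here the sum over exterior sites is recovered. -/
lemma plusField_eq_tsum (hJ : IsFerromagnetic J) (Λ : Finset (Site d)) (x : Site d) :
    plusField J Λ x = ∑' y : {y : Site d // y ∉ Λ}, J x y := by
  rw [plusField, ← hJ.tsum_eq x, ← (hJ.summable x).sum_add_tsum_subtype_compl Λ, add_sub_cancel_left]

lemma plusField_nonneg (hJ : IsFerromagnetic J) (Λ : Finset (Site d)) (x : Site d) :
    0 ≤ plusField J Λ x := by
  rw [plusField_eq_tsum hJ]
  exact tsum_nonneg fun y => hJ.nonneg x y

lemma coupling_nonneg (hJ : IsFerromagnetic J) (hβ : 0 ≤ β) (p : Site d × Site d) :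
    0 ≤ coupling J β p := by
  rw [coupling]
  split_ifs
  · exact mul_nonneg (by positivity) (hJ.nonneg _ _)
  · exact le_rfl

lemma bondWeight_pos (S : Finset (Site d × Site d)) (σ : Config d) : 0 < bondWeight J β S σ :=
  Real.exp_pos _

lemma isFerroWeight_bondWeight (hJ : IsFerromagnetic J) (hβ : 0 ≤ β)
    (S : Finset (Site d × Site d)) : IsFerroWeight (bondWeight J β S) :=
  isFerroWeight_exp_sum S (fun p _ => coupling_nonneg hJ hβ p) pairChar

lemma bondWeight_mem_posCone (hJ : IsFerromagnetic J) (hβ : 0 ≤ β)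
    (S : Finset (Site d × Site d)) : bondWeight J β S ∈ posCone (Config d) :=
  exp_sum_mem_posCone S (fun p _ => coupling_nonneg hJ hβ p) pairChar

lemma bondWeight_union [DecidableEq (Site d × Site d)] {S T : Finset (Site d × Site d)}
    (h : Disjoint S T) (σ : Config d) :
    bondWeight J β (S ∪ T) σ = bondWeight J β S σ * bondWeight J β T σ := by
  rw [bondWeight, Finset.sum_union h, Real.exp_add, bondWeight, bondWeight]

lemma dependsOn_bondWeight {S : Finset (Site d × Site d)} {Λ : Finset (Site d)}
    (h : S ⊆ Λ ×ˢ Λ) : DependsOn (bondWeight J β S) (Λ : Set (Site d)) := by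
  intro σ τ hστ
  simp only [bondWeight, spin_pairChar]
  congr 1
  refine Finset.sum_congr rfl fun p hp => ?_
  obtain ⟨h1, h2⟩ := Finset.mem_product.1 (h hp)
  rw [hστ _ h1, hστ _ h2]

/-- The translate of a finite set of ordered pairs. -/
def translatePairs (x : Site d) (S : Finset (Site d × Site d)) : Finset (Site d × Site d) :=
  S.map ((addRightEmbedding x).prodMap (addRightEmbedding x))

lemma translatePairs_product (x : Site d) (Λ : Finset (Site d)) :
    translatePairs x (Λ ×ˢ Λ) = translateSites x Λ ×ˢ translateSites x Λ :=
  Finset.prodMap_map_product _ _ _ _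

lemma bondWeight_shift (hJ : IsFerromagnetic J) (x : Site d) (S : Finset (Site d × Site d))
    (σ : Config d) : bondWeight J β (translatePairs x S) σ = bondWeight J β S (shift x σ) := by
  rw [bondWeight, translatePairs, Finset.sum_map, bondWeight]
  simp [spin_pairChar, coupling, addRightEmbedding, shift, hJ.add_right]

lemma plusField_shift (hJ : IsFerromagnetic J) (x : Site d) (Λ : Finset (Site d)) (y : Site d) :
    plusField J (translateSites x Λ) (y + x) = plusField J Λ y := by
  simp [plusField, translateSites, addRightEmbedding, hJ.add_right]

lemma isVolumeWeight_freeWeight (hJ : IsFerromagnetic J) (hβ : 0 ≤ β) :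
    IsVolumeWeight (freeWeight J β) where
  pos Λ σ := bondWeight_pos _ σ
  dependsOn Λ := dependsOn_bondWeight subset_rfl
  ferro Λ := isFerroWeight_bondWeight hJ hβ _
  shift x Λ σ := by
    rw [freeWeight, ← translatePairs_product, bondWeight_shift hJ, freeWeight]

lemma isVolumeWeight_plusWeight (hJ : IsFerromagnetic J) (hβ : 0 ≤ β) :
    IsVolumeWeight (plusWeight J β) where
  pos Λ σ := mul_pos (bondWeight_pos _ σ) (Real.exp_pos _)
  dependsOn Λ := by
    refine DependsOn.mul' ((isVolumeWeight_freeWeight hJ hβ).dependsOn Λ) fun σ τ h => ?_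
    simp only [siteChar_apply]
    congr 1
    exact Finset.sum_congr rfl fun x hx => by rw [h x hx]
  ferro Λ := ((isVolumeWeight_freeWeight hJ hβ).ferro Λ).mul
    (isFerroWeight_exp_sum Λ (fun x _ => mul_nonneg hβ (plusField_nonneg hJ Λ x)) siteChar)
  shift x Λ σ := by
    rw [plusWeight, (isVolumeWeight_freeWeight hJ hβ).shift, plusWeight]
    congr 2
    rw [show translateSites x Λ = Λ.map (addRightEmbedding x) from rfl, Finset.sum_map]
    refine Finset.sum_congr rfl fun y _ => ?_
    have := plusField_shift hJ x Λ y
    rw [translateSites] at this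
    rw [addRightEmbedding_apply, this]
    rfl

lemma finiteGibbs_eq_gibbs {h : ℝ} {τ : Site d → SignType} {Λ : Finset (Site d)}
    {w : Finset (Site d) → Config d → ℝ}
    (hw : ∀ σ, Real.exp (-β * hamiltonian J h τ Λ σ) = w Λ (extend Λ σ)) (f : Config d → ℝ) :
    finiteGibbs J β h τ Λ f = gibbs w Λ f := by
  rw [gibbs_apply, avg_apply, avg_apply, div_div_div_cancel_right₀ (by positivity), finiteGibbs,
    partitionFunction, Finset.sum_div]
  simp only [hw, mul_div_assoc]

lemma sum_pairs_extend (Λ : Finset (Site d)) (σ : Λ → ℤˣ) :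
    ∑ p ∈ Λ ×ˢ Λ, coupling J β p * spin (pairChar p (extend Λ σ)) =
      β * ((1 / 2) * ∑ x : Λ, ∑ y : Λ, if x ≠ y then J x y * spin (σ x) * spin (σ y) else 0) := by
  rw [Finset.sum_product, ← Finset.sum_coe_sort, Finset.mul_sum, Finset.mul_sum]
  refine Finset.sum_congr rfl fun x _ => ?_
  rw [← Finset.sum_coe_sort, Finset.mul_sum, Finset.mul_sum]
  refine Finset.sum_congr rfl fun y _ => ?_
  rw [spin_pairChar, extend_apply_mem σ x.2, extend_apply_mem σ y.2, coupling]
  by_cases hxy : x = y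
  · simp [hxy]
  · simp [hxy, Subtype.coe_injective.ne hxy]
    ring

lemma finiteGibbs_free (Λ : Finset (Site d)) (f : Config d → ℝ) :
    finiteGibbs J β 0 (fun _ => 0) Λ f = gibbs (freeWeight J β) Λ f := by
  refine finiteGibbs_eq_gibbs (fun σ => ?_) f
  rw [freeWeight, bondWeight, sum_pairs_extend, hamiltonian]
  simp

lemma finiteGibbs_plus (hJ : IsFerromagnetic J) (Λ : Finset (Site d)) (f : Config d → ℝ) :
    finiteGibbs J β 0 (fun _ => 1) Λ f = gibbs (plusWeight J β) Λ f := by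
  refine finiteGibbs_eq_gibbs (fun σ => ?_) f
  rw [plusWeight, freeWeight, bondWeight, sum_pairs_extend, hamiltonian, ← Real.exp_add]
  congr 1
  have h : ∑ x ∈ Λ, β * plusField J Λ x * spin (siteChar x (extend Λ σ)) =
      β * ∑ x : Λ, ∑' y : {y : Site d // y ∉ Λ}, J x y * spin (σ x) * ((1 : SignType) : ℝ) := by
    rw [← Finset.sum_coe_sort, Finset.mul_sum]
    refine Finset.sum_congr rfl fun x _ => ?_
    rw [siteChar_apply, extend_apply_mem σ x.2, plusField_eq_tsum hJ, mul_assoc, ← tsum_mul_right]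
    simp
  rw [h]
  simp
  ring

end Ferromagnetic

/-! ### Comparison of volumes -/

variable {w : Finset (Site d) → Config d → ℝ}

/-- Spins outside `Λ` do not enter the weight and average out, so that states in different volumes
can be compared inside one average over `M`. -/
lemma gibbs_of_subset (hw : IsVolumeWeight w) {Λ M : Finset (Site d)} (h : Λ ⊆ M)
    {f : Config d → ℝ} (hf : DependsOn f (Λ : Set (Site d))) :
    gibbs w Λ f = avg M (fun σ => f σ * w Λ σ) / avg M (w Λ) := by
  rw [gibbs_apply, avg_congr subset_rfl h (hf.mul' (hw.dependsOn Λ)),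
    avg_congr subset_rfl h (hw.dependsOn Λ)]

lemma gibbs_shift (hw : IsVolumeWeight w) {Λ : Finset (Site d)} (x : Site d)
    {f : Config d → ℝ} (hf : DependsOn f (Λ : Set (Site d))) :
    gibbs w (translateSites x Λ) (fun σ => f (shift x σ)) = gibbs w Λ f := by
  rw [gibbs_apply, gibbs_apply, ← avg_shift x subset_rfl subset_rfl (hf.mul' (hw.dependsOn Λ)),
    ← avg_shift x subset_rfl subset_rfl (hw.dependsOn Λ)]
  have : w (translateSites x Λ) = fun σ => w Λ (shift x σ) := by
    ext σ
    exact hw.shift x Λ σ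
  simp only [this]

lemma gibbs_const (hw : IsVolumeWeight w) (Λ : Finset (Site d)) (c : ℝ) :
    gibbs w Λ (fun _ => c) = c := by
  rw [gibbs_apply, avg_mul_const, mul_div_cancel_right₀ _ (avg_pos Λ (hw.pos Λ)).ne']

lemma gibbs_mono (hw : IsVolumeWeight w) (Λ : Finset (Site d)) {f g : Config d → ℝ}
    (h : ∀ σ, f σ ≤ g σ) : gibbs w Λ f ≤ gibbs w Λ g := by
  rw [gibbs_apply, gibbs_apply]
  exact div_le_div_of_nonneg_right
    (avg_mono Λ fun σ => mul_le_mul_of_nonneg_right (h σ) (hw.pos Λ σ).le)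
    (avg_pos Λ (hw.pos Λ)).le

/-- The second Griffiths inequality in finite volume. -/
lemma gibbs_mul_le (hw : IsVolumeWeight w) (Λ : Finset (Site d)) {f g : Config d → ℝ}
    (hf : f ∈ posCone (Config d)) (hg : g ∈ posCone (Config d)) :
    gibbs w Λ f * gibbs w Λ g ≤ gibbs w Λ (fun σ => f σ * g σ) := by
  have hZ := avg_pos Λ (hw.pos Λ)
  rw [gibbs_apply, gibbs_apply, gibbs_apply, div_mul_div_comm, div_le_div_iff₀ (by positivity) hZ]
  nlinarith [avg_griffiths Λ hf hg (hw.ferro Λ)]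

/-- The indicator of `σ = 1` on `A`, up to normalization. -/
noncomputable def plusProd (A : Finset (Site d)) (σ : Config d) : ℝ := ∏ x ∈ A, (1 + spin (σ x))

lemma plusProd_nonneg (A : Finset (Site d)) (σ : Config d) : 0 ≤ plusProd A σ :=
  Finset.prod_nonneg fun x _ => by linarith [neg_one_le_spin (σ x)]

lemma plusProd_mem_posCone (A : Finset (Site d)) : plusProd A ∈ posCone (Config d) :=
  prod_mem_posCone A fun x _ => one_add_char_mem_posCone (siteChar x)

lemma isFerroWeight_plusProd (A : Finset (Site d)) : IsFerroWeight (plusProd A) :=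
  IsFerroWeight.prod A fun x _ => isFerroWeight_one_add_char (siteChar x)

lemma dependsOn_plusProd (A : Finset (Site d)) : DependsOn (plusProd A) (A : Set (Site d)) :=
  fun σ τ h => Finset.prod_congr rfl fun x hx => by rw [h x hx]

lemma plusProd_eq_zero_or (A : Finset (Site d)) (σ : Config d) :
    plusProd A σ = 0 ∨ ∀ x ∈ A, σ x = 1 := by
  by_cases h : ∀ x ∈ A, σ x = 1
  · exact Or.inr h
  · push Not at h
    obtain ⟨x, hx, hx1⟩ := h
    refine Or.inl (Finset.prod_eq_zero hx ?_)
    rw [(Int.units_eq_one_or (σ x)).resolve_left hx1]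
    simp [spin]

lemma avg_plusProd (Λ A : Finset (Site d)) (h : A ⊆ Λ) : 0 < avg Λ (plusProd A) := by
  refine div_pos (Finset.sum_pos' (fun σ _ => plusProd_nonneg A _) ⟨1, Finset.mem_univ _, ?_⟩)
    (by positivity)
  refine Finset.prod_pos fun x hx => ?_
  rw [extend_apply_mem _ (h hx)]
  simp [spin]

/-! ### Plus conditioning and monotonicity in the volume -/

variable {J : Site d → Site d → ℝ} {β : ℝ}

/-- Conditioning on `σ = 1` outside `Λ` turns the weight in `Λ'` into the one in `Λ`. -/
lemma plusWeight_mul_plusProd (hJ : IsFerromagnetic J) {Λ Λ' : Finset (Site d)} (h : Λ ⊆ Λ') :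
    ∃ c : ℝ, 0 < c ∧ ∀ σ, plusProd (Λ' \ Λ) σ * plusWeight J β Λ' σ =
      c * (plusProd (Λ' \ Λ) σ * plusWeight J β Λ σ) := by
  -- The constant collects the energy of the frozen spins among themselves and in the exterior field
  -- of `Λ'`.
  refine ⟨Real.exp (∑ x ∈ Λ' \ Λ, ∑ y ∈ Λ' \ Λ, coupling J β (x, y) +
    ∑ x ∈ Λ' \ Λ, β * plusField J Λ' x), Real.exp_pos _, fun σ => ?_⟩
  rcases plusProd_eq_zero_or (Λ' \ Λ) σ with h0 | h1
  · simp [h0]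
  rw [mul_left_comm]
  congr 1
  simp only [plusWeight, freeWeight, bondWeight, ← Real.exp_add]
  congr 1
  simp only [Finset.sum_product, spin_pairChar, siteChar_apply]
  have split : ∀ F : Site d → ℝ, ∑ x ∈ Λ', F x = ∑ x ∈ Λ, F x + ∑ x ∈ Λ' \ Λ, F x := fun F => by
    rw [add_comm, Finset.sum_sdiff h]
  simp only [split]
  have e1 : ∀ (F : Site d → ℝ), ∑ x ∈ Λ' \ Λ, F x * spin (σ x) = ∑ x ∈ Λ' \ Λ, F x := fun F =>
    Finset.sum_congr rfl fun x hx => by rw [h1 x hx, spin_one, mul_one]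
  have e2 : ∑ x ∈ Λ, ∑ y ∈ Λ' \ Λ, coupling J β (x, y) * (spin (σ x) * spin (σ y)) =
      ∑ x ∈ Λ, (β / 2 * ∑ y ∈ Λ' \ Λ, J x y) * spin (σ x) := by
    refine Finset.sum_congr rfl fun x hx => ?_
    rw [Finset.mul_sum, Finset.sum_mul]
    refine Finset.sum_congr rfl fun y hy => ?_
    have : x ≠ y := fun hxy => (Finset.mem_sdiff.1 hy).2 (hxy ▸ hx)
    rw [h1 y hy, spin_one, mul_one, coupling, if_pos this]
  have e3 : ∑ x ∈ Λ' \ Λ, ∑ y ∈ Λ, coupling J β (x, y) * (spin (σ x) * spin (σ y)) =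
      ∑ x ∈ Λ, (β / 2 * ∑ y ∈ Λ' \ Λ, J x y) * spin (σ x) := by
    rw [Finset.sum_comm, ← e2]
    refine Finset.sum_congr rfl fun x hx => Finset.sum_congr rfl fun y hy => ?_
    simp only [coupling, hJ.symm y x, ne_comm (a := y), mul_comm (spin (σ y))]
  have e4 : ∑ x ∈ Λ' \ Λ, ∑ y ∈ Λ' \ Λ, coupling J β (x, y) * (spin (σ x) * spin (σ y)) =
      ∑ x ∈ Λ' \ Λ, ∑ y ∈ Λ' \ Λ, coupling J β (x, y) :=
    Finset.sum_congr rfl fun x hx => Finset.sum_congr rfl fun y hy => by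
      rw [h1 x hx, h1 y hy, spin_one, mul_one, mul_one]
  -- The bonds from `Λ` to the frozen spins, counted in both orders by `e2` and `e3`, supply exactly
  -- the field missing from `plusField J Λ'`.
  have e5 : ∑ x ∈ Λ, β * plusField J Λ' x * spin (σ x) =
      ∑ x ∈ Λ, β * plusField J Λ x * spin (σ x) -
        2 * ∑ x ∈ Λ, (β / 2 * ∑ y ∈ Λ' \ Λ, J x y) * spin (σ x) := by
    rw [Finset.mul_sum, ← Finset.sum_sub_distrib]
    refine Finset.sum_congr rfl fun x _ => ?_
    rw [plusField, plusField, split]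
    ring
  simp only [Finset.sum_add_distrib, e1, e2, e3, e4, e5]
  ring

/-- In a plus state, expectations in the cone decrease with the volume, also after conditioning
on plus spins. -/
lemma plus_gibbs_le (hJ : IsFerromagnetic J) (hβ : 0 ≤ β) {A Λ Λ' : Finset (Site d)} (h : Λ ⊆ Λ')
    (hA : A ⊆ Λ' \ Λ) {f : Config d → ℝ} (hf : f ∈ posCone (Config d))
    (hfΛ : DependsOn f (Λ : Set (Site d))) :
    gibbs (plusWeight J β) Λ' (fun σ => plusProd A σ * f σ) ≤
      gibbs (plusWeight J β) Λ' (plusProd A) * gibbs (plusWeight J β) Λ f := by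
  have hw := isVolumeWeight_plusWeight hJ hβ
  obtain ⟨c, hc, hcw⟩ := plusWeight_mul_plusProd (β := β) hJ h
  set I := plusProd (Λ' \ Λ) with hI
  -- Where `I` does not vanish, each factor of `plusProd A` equals `2`.
  have hIA : ∀ σ, I σ * plusProd A σ = 2 ^ A.card * I σ := fun σ => by
    rcases plusProd_eq_zero_or (Λ' \ Λ) σ with h0 | h1
    · simp [hI, h0]
    · have : plusProd A σ = 2 ^ A.card := by
        rw [plusProd, Finset.prod_congr rfl fun x hx => by rw [h1 x (hA hx)], Finset.prod_const,
          spin_one]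
        norm_num
      rw [this, mul_comm]
  -- The conditioning on `A` is absorbed into the weight. Griffiths' inequality then says that
  -- freezing the rest of `Λ' \ Λ` as well raises the mean of `f`.
  have key := avg_griffiths Λ' hf (plusProd_mem_posCone (Λ' \ Λ))
    ((isFerroWeight_plusProd A).mul (hw.ferro Λ'))
  rw [← hI] at key
  have e1 : avg Λ' (fun σ => I σ * (plusProd A σ * plusWeight J β Λ' σ)) =
      2 ^ A.card * c * (avg Λ' I * avg Λ' (plusWeight J β Λ)) := by
    rw [← avg_mul (A := Λ' \ Λ) (B := Λ) Finset.sdiff_subset h Finset.sdiff_disjoint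
      (dependsOn_plusProd _) (hw.dependsOn Λ), ← avg_mul_const]
    congr 1
    ext σ
    rw [← mul_assoc, hIA, mul_assoc, hcw]
    ring
  have e2 : avg Λ' (fun σ => f σ * I σ * (plusProd A σ * plusWeight J β Λ' σ)) =
      2 ^ A.card * c * (avg Λ' I * avg Λ' (fun σ => f σ * plusWeight J β Λ σ)) := by
    rw [← avg_mul (A := Λ' \ Λ) (B := Λ) Finset.sdiff_subset h Finset.sdiff_disjoint
      (dependsOn_plusProd _) (hfΛ.mul' (hw.dependsOn Λ)), ← avg_mul_const]
    congr 1
    ext σ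
    linear_combination (f σ * plusWeight J β Λ' σ) * hIA σ + 2 ^ A.card * f σ * hcw σ
  rw [e1, e2] at key
  have hIpos : 0 < avg Λ' I := avg_plusProd Λ' _ Finset.sdiff_subset
  have hZ := avg_pos Λ' (hw.pos Λ')
  have hZ' := avg_pos Λ' (hw.pos Λ)
  have hpos : 0 < 2 ^ A.card * c * avg Λ' I := by positivity
  have key' : avg Λ' (fun σ => f σ * (plusProd A σ * plusWeight J β Λ' σ)) *
      avg Λ' (plusWeight J β Λ) ≤ avg Λ' (fun σ => f σ * plusWeight J β Λ σ) *
        avg Λ' (fun σ => plusProd A σ * plusWeight J β Λ' σ) := by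
    refine le_of_mul_le_mul_left ?_ hpos
    linarith
  rw [gibbs_of_subset hw h hfΛ, gibbs_apply, gibbs_apply, div_mul_div_comm,
    div_le_div_iff₀ hZ (by positivity)]
  have e3 : (fun σ => plusProd A σ * f σ * plusWeight J β Λ' σ) =
      fun σ => f σ * (plusProd A σ * plusWeight J β Λ' σ) := by
    ext σ
    ring
  rw [e3]
  have := mul_le_mul_of_nonneg_right key' hZ.le
  linarith

lemma plus_gibbs_antitone (hJ : IsFerromagnetic J) (hβ : 0 ≤ β) {Λ Λ' : Finset (Site d)}
    (h : Λ ⊆ Λ') {f : Config d → ℝ} (hf : f ∈ posCone (Config d))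
    (hfΛ : DependsOn f (Λ : Set (Site d))) :
    gibbs (plusWeight J β) Λ' f ≤ gibbs (plusWeight J β) Λ f := by
  have := plus_gibbs_le hJ hβ h (Finset.empty_subset _) hf hfΛ
  have h1 : plusProd (∅ : Finset (Site d)) = fun _ => 1 := by
    ext σ
    simp [plusProd]
  simpa only [h1, one_mul, gibbs_const (isVolumeWeight_plusWeight hJ hβ)] using this

/-- The bonds of `Λ'` that are not in `Λ` contribute a factor in the cone, which is positively
correlated with `f` under the weight of `Λ`. -/
lemma free_gibbs_monotone (hJ : IsFerromagnetic J) (hβ : 0 ≤ β) {Λ Λ' : Finset (Site d)}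
    (h : Λ ⊆ Λ') {f : Config d → ℝ} (hf : f ∈ posCone (Config d))
    (hfΛ : DependsOn f (Λ : Set (Site d))) :
    gibbs (freeWeight J β) Λ f ≤ gibbs (freeWeight J β) Λ' f := by
  classical
  have hw := isVolumeWeight_freeWeight hJ hβ
  have hsub : Λ ×ˢ Λ ⊆ Λ' ×ˢ Λ' := Finset.product_subset_product h h
  have e : ∀ σ, freeWeight J β Λ' σ =
      bondWeight J β ((Λ' ×ˢ Λ') \ (Λ ×ˢ Λ)) σ * freeWeight J β Λ σ := fun σ => by
    rw [freeWeight, freeWeight, ← bondWeight_union Finset.sdiff_disjoint,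
      Finset.sdiff_union_of_subset hsub]
  have key := avg_griffiths Λ' hf (bondWeight_mem_posCone hJ hβ ((Λ' ×ˢ Λ') \ (Λ ×ˢ Λ)))
    (hw.ferro Λ)
  simp only [mul_assoc, ← e] at key
  rw [gibbs_of_subset hw h hfΛ, gibbs_apply,
    div_le_div_iff₀ (avg_pos Λ' (hw.pos Λ)) (avg_pos Λ' (hw.pos Λ'))]
  exact key

end Weights

/-! ### Infinite volume states -/

section InfiniteVolume

variable {d : ℕ}

instance instBorelSpaceIntUnits : BorelSpace ℤˣ where
  measurable_eq := by
    have h1 : (⊤ : MeasurableSpace ℤˣ) = borel ℤˣ := borel_eq_top_of_discrete.symm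
    rw [← h1]
    refine top_le_iff.1 fun s _ => ?_
    exact ⟨Units.val '' s, trivial, Set.preimage_image_eq s Units.val_injective⟩

lemma IsLocal.continuous {f : Config d → ℝ} (hf : IsLocal f) : Continuous f := by
  obtain ⟨A, hA⟩ := hf
  have : f = (fun σ : A → ℤˣ => f (extend A σ)) ∘ fun σ (x : A) => σ x := by
    ext σ
    exact hA fun x hx => (extend_apply_mem (fun x : A => σ x) (Finset.mem_coe.1 hx)).symm
  rw [this]
  exact continuous_of_discreteTopology.comp (by fun_prop)

lemma IsLocal.integrable {f : Config d → ℝ} (hf : IsLocal f) (μ : ProbabilityMeasure (Config d)) :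
    Integrable f (μ : Measure (Config d)) :=
  (BoundedContinuousFunction.mkOfCompact ⟨f, hf.continuous⟩).integrable _

/-- `μ` is the limit of the finite volume states with weights `w`. -/
def IsLimitState (w : Finset (Site d) → Config d → ℝ) (μ : ProbabilityMeasure (Config d)) : Prop :=
  ∀ f : Config d → ℝ, IsLocal f →
    Tendsto (fun Λ => gibbs w Λ f) atTop (𝓝 (∫ σ, f σ ∂(μ : Measure (Config d))))

lemma isLocal_indicator_cylinder {A : Finset (Site d)} (S : Set (A → ℤˣ)) :
    IsLocal ((cylinder A S).indicator fun _ => (1 : ℝ)) := by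
  refine ⟨A, fun σ τ h => ?_⟩
  have : σ ∈ cylinder A S ↔ τ ∈ cylinder A S := by
    rw [mem_cylinder, mem_cylinder]
    have : A.restrict σ = A.restrict τ := by
      ext x
      exact congrArg Units.val (h x x.2)
    rw [this]
  by_cases hσ : σ ∈ cylinder A S
  · rw [Set.indicator_of_mem hσ, Set.indicator_of_mem (this.1 hσ)]
  · rw [Set.indicator_of_notMem hσ, Set.indicator_of_notMem (mt this.2 hσ)]

lemma measure_eq_of_forall_isLocal {μ ν : Measure (Config d)} [IsProbabilityMeasure μ]
    [IsProbabilityMeasure ν] (h : ∀ f : Config d → ℝ, IsLocal f → ∫ σ, f σ ∂μ = ∫ σ, f σ ∂ν) :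
    μ = ν := by
  refine ext_of_generate_finite (measurableCylinders fun _ : Site d => ℤˣ)
    generateFrom_measurableCylinders.symm isPiSystem_measurableCylinders ?_ (by simp)
  intro s hs
  obtain ⟨A, S, hS, rfl⟩ := (mem_measurableCylinders _).1 hs
  have := h _ (isLocal_indicator_cylinder S)
  rw [integral_indicator_const _ (hS.cylinder A), integral_indicator_const _ (hS.cylinder A)] at this
  simpa [measureReal_def, ENNReal.toReal_eq_toReal_iff'] using this

/-- Probability measures on the compact configuration space form a compact space. A limit along an
ultrafilter finer than `l` must have the prescribed limits as its local expectations. -/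
lemma exists_limit_of_tendsto {ι : Type*} {l : Filter ι} [NeBot l]
    (ν : ι → ProbabilityMeasure (Config d))
    (h : ∀ f : Config d → ℝ, IsLocal f →
      ∃ a, Tendsto (fun i => ∫ σ, f σ ∂(ν i : Measure (Config d))) l (𝓝 a)) :
    ∃ μ : ProbabilityMeasure (Config d), ∀ f : Config d → ℝ, IsLocal f →
      Tendsto (fun i => ∫ σ, f σ ∂(ν i : Measure (Config d))) l
        (𝓝 (∫ σ, f σ ∂(μ : Measure (Config d)))) := by
  let U := Ultrafilter.of l
  have hU : (U : Filter ι) ≤ l := Ultrafilter.of_le l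
  obtain ⟨μ, -, hμ⟩ := isCompact_univ.ultrafilter_le_nhds' (U.map ν) univ_mem
  refine ⟨μ, fun f hf => ?_⟩
  obtain ⟨a, ha⟩ := h f hf
  have hlim : Tendsto ν U (𝓝 μ) := hμ
  have := (ProbabilityMeasure.tendsto_iff_forall_integral_tendsto.1 hlim)
    (BoundedContinuousFunction.mkOfCompact ⟨f, hf.continuous⟩)
  have heq : a = ∫ σ, f σ ∂(μ : Measure (Config d)) :=
    tendsto_nhds_unique (ha.mono_left hU) this
  exact heq ▸ ha

variable {w : Finset (Site d) → Config d → ℝ}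

/-- The finite volume state as a measure, with spins `1` outside of the volume. -/
noncomputable def gibbsMeasure (w : Finset (Site d) → Config d → ℝ) (Λ : Finset (Site d)) :
    Measure (Config d) :=
  ∑ σ : Λ → ℤˣ, ENNReal.ofReal (w Λ (extend Λ σ) / ∑ τ : Λ → ℤˣ, w Λ (extend Λ τ)) •
    Measure.dirac (extend Λ σ)

lemma gibbs_eq_sum (w : Finset (Site d) → Config d → ℝ) (Λ : Finset (Site d)) (f : Config d → ℝ) :
    gibbs w Λ f = ∑ σ : Λ → ℤˣ,
      w Λ (extend Λ σ) / (∑ τ : Λ → ℤˣ, w Λ (extend Λ τ)) * f (extend Λ σ) := by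
  rw [gibbs_apply, avg_apply, avg_apply, div_div_div_cancel_right₀ (by positivity), Finset.sum_div]
  exact Finset.sum_congr rfl fun σ _ => by ring

lemma integral_gibbsMeasure (hw : IsVolumeWeight w) (Λ : Finset (Site d)) (f : Config d → ℝ) :
    ∫ σ, f σ ∂(gibbsMeasure w Λ) = gibbs w Λ f := by
  have hpos : ∀ σ : Λ → ℤˣ, 0 ≤ w Λ (extend Λ σ) / ∑ τ : Λ → ℤˣ, w Λ (extend Λ τ) := fun σ =>
    div_nonneg (hw.pos _ _).le (Finset.sum_nonneg fun _ _ => (hw.pos _ _).le)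
  rw [gibbsMeasure, integral_finsetSum_measure, gibbs_eq_sum]
  · refine Finset.sum_congr rfl fun σ _ => ?_
    rw [integral_smul_measure, integral_dirac, ENNReal.toReal_ofReal (hpos σ), smul_eq_mul]
  · intro σ _
    exact (integrable_dirac (by simp)).smul_measure ENNReal.ofReal_ne_top

lemma isProbabilityMeasure_gibbsMeasure (hw : IsVolumeWeight w) (Λ : Finset (Site d)) :
    IsProbabilityMeasure (gibbsMeasure w Λ) := by
  have hpos : 0 < ∑ τ : Λ → ℤˣ, w Λ (extend Λ τ) :=
    Finset.sum_pos (fun _ _ => hw.pos _ _) ⟨1, Finset.mem_univ _⟩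
  refine ⟨?_⟩
  rw [gibbsMeasure, Measure.finsetSum_apply]
  simp only [Measure.smul_apply, measure_univ, smul_eq_mul, mul_one]
  rw [← ENNReal.ofReal_sum_of_nonneg fun σ _ => div_nonneg (hw.pos _ _).le hpos.le,
    ← Finset.sum_div, div_self hpos.ne', ENNReal.ofReal_one]

lemma exists_isLimitState (hw : IsVolumeWeight w)
    (h : ∀ A : Finset (Site d), ∃ a, Tendsto (fun Λ => gibbs w Λ (spinProd A)) atTop (𝓝 a)) :
    ∃ μ, IsLimitState w μ := by
  have hloc : ∀ f : Config d → ℝ, IsLocal f →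
      ∃ a, Tendsto (fun Λ => gibbs w Λ f) atTop (𝓝 a) := by
    intro f hf
    have hspan := hf.mem_span
    clear hf
    induction hspan using Submodule.span_induction with
    | mem x hx =>
      obtain ⟨A, rfl⟩ := hx
      exact h A
    | zero => exact ⟨0, by simp⟩
    | add x y _ _ hx hy =>
      obtain ⟨a, ha⟩ := hx
      obtain ⟨b, hb⟩ := hy
      exact ⟨a + b, by simpa using ha.add hb⟩
    | smul c x _ hx =>
      obtain ⟨a, ha⟩ := hx
      exact ⟨c * a, by simpa using ha.const_mul c⟩
  obtain ⟨μ, hμ⟩ := exists_limit_of_tendsto (l := atTop)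
    (fun Λ => ⟨gibbsMeasure w Λ, isProbabilityMeasure_gibbsMeasure hw Λ⟩)
    fun f hf => by simpa [integral_gibbsMeasure hw] using hloc f hf
  exact ⟨μ, fun f hf => by simpa [integral_gibbsMeasure hw] using hμ f hf⟩

lemma IsLimitState.unique {μ ν : ProbabilityMeasure (Config d)} (hμ : IsLimitState w μ)
    (hν : IsLimitState w ν) : μ = ν :=
  Subtype.ext (@measure_eq_of_forall_isLocal d μ ν μ.2 ν.2 fun f hf =>
    tendsto_nhds_unique (hμ f hf) (hν f hf))

lemma measurable_shift (x : Site d) : Measurable (shift x) :=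
  measurable_pi_lambda _ fun y => measurable_pi_apply (y + x)

lemma measurable_neg_config : Measurable fun σ : Config d => -σ :=
  measurable_pi_lambda _ fun y =>
    (continuous_of_discreteTopology (f := fun s : ℤˣ => -s)).measurable.comp (measurable_pi_apply y)

lemma measurePreserving_of_forall_isLocal {μ : ProbabilityMeasure (Config d)}
    {φ : Config d → Config d} (hφ : Measurable φ)
    (h : ∀ f : Config d → ℝ, IsLocal f →
      ∫ σ, f (φ σ) ∂(μ : Measure (Config d)) = ∫ σ, f σ ∂(μ : Measure (Config d))) :
    MeasurePreserving φ (μ : Measure (Config d)) (μ : Measure (Config d)) := by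
  refine ⟨hφ, ?_⟩
  have := Measure.isProbabilityMeasure_map (μ := (μ : Measure (Config d))) hφ.aemeasurable
  refine measure_eq_of_forall_isLocal fun f hf => ?_
  rw [integral_map hφ.aemeasurable hf.continuous.aestronglyMeasurable, h f hf]

lemma tendsto_translateSites (x : Site d) :
    Tendsto (translateSites x) (atTop : Filter (Finset (Site d))) atTop := by
  refine tendsto_atTop.2 fun Λ => ?_
  filter_upwards [eventually_ge_atTop (translateSites (-x) Λ)] with Λ' h y hy
  rw [mem_translateSites]
  exact h (mem_translateSites.2 (by simpa using hy))

/-- The limit runs over all finite volumes, so translating them does not change it, while the finite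
volume states are translation covariant. -/
lemma IsLimitState.measurePreserving_shift (hw : IsVolumeWeight w)
    {μ : ProbabilityMeasure (Config d)} (hμ : IsLimitState w μ) (x : Site d) :
    MeasurePreserving (shift x) (μ : Measure (Config d)) (μ : Measure (Config d)) := by
  refine measurePreserving_of_forall_isLocal (measurable_shift x) fun f hf => ?_
  refine tendsto_nhds_unique ((hμ _ (hf.shift x)).comp (tendsto_translateSites x))
    ((hμ f hf).congr' ?_)
  obtain ⟨A, hA⟩ := hf
  filter_upwards [eventually_ge_atTop A] with Λ hΛ
  exact (gibbs_shift hw x (hA.mono (Finset.coe_subset.2 hΛ))).symm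

lemma IsLimitState.measurePreserving_neg (hw : IsVolumeWeight w) (hneg : ∀ Λ σ, w Λ (-σ) = w Λ σ)
    {μ : ProbabilityMeasure (Config d)} (hμ : IsLimitState w μ) :
    MeasurePreserving (fun σ : Config d => -σ) (μ : Measure (Config d))
      (μ : Measure (Config d)) := by
  refine measurePreserving_of_forall_isLocal measurable_neg_config fun f hf => ?_
  obtain ⟨A, hA⟩ := hf
  have hlocal : IsLocal fun σ => f (-σ) := ⟨A, fun σ τ h => hA fun x hx => by simp [h x hx]⟩
  refine tendsto_nhds_unique (hμ _ hlocal) ((hμ f ⟨A, hA⟩).congr' ?_)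
  filter_upwards [eventually_ge_atTop A] with Λ hΛ
  rw [gibbs_apply, gibbs_apply,
    ← avg_neg subset_rfl ((hA.mono (Finset.coe_subset.2 hΛ)).mul' (hw.dependsOn Λ))]
  simp only [hneg]

/-! ### Existence of the plus and free states -/

variable {J : Site d → Site d → ℝ} {β : ℝ}

lemma isPlusState_iff (hJ : IsFerromagnetic J) {μ : ProbabilityMeasure (Config d)} :
    IsPlusState J β μ ↔ IsLimitState (plusWeight J β) μ := by
  simp only [IsPlusState, IsInfiniteVolumeState, IsLimitState, finiteGibbs_plus hJ]

lemma isFreeState_iff {μ : ProbabilityMeasure (Config d)} :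
    IsFreeState J β μ ↔ IsLimitState (freeWeight J β) μ := by
  simp only [IsFreeState, IsInfiniteVolumeState, IsLimitState, finiteGibbs_free]

lemma freeWeight_neg (Λ : Finset (Site d)) (σ : Config d) :
    freeWeight J β Λ (-σ) = freeWeight J β Λ σ := by
  simp [freeWeight, bondWeight, spin_pairChar, spin_neg]

lemma spinProd_mem_posCone (A : Finset (Site d)) : spinProd A ∈ posCone (Config d) :=
  char_mem_posCone (spinChar A)

lemma abs_gibbs_spinProd_le (hw : IsVolumeWeight w) (Λ A : Finset (Site d)) :
    |gibbs w Λ (spinProd A)| ≤ 1 := by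
  refine abs_le.2 ⟨?_, ?_⟩
  · exact (gibbs_const hw Λ (-1)).symm.trans_le (gibbs_mono hw Λ fun σ => neg_one_le_spin _)
  · exact (gibbs_mono hw Λ fun σ => spin_le_one _).trans_eq (gibbs_const hw Λ 1)

lemma exists_plus_limit (hJ : IsFerromagnetic J) (hβ : 0 ≤ β) :
    ∃ μ, IsLimitState (plusWeight J β) μ := by
  classical
  have hw := isVolumeWeight_plusWeight hJ hβ
  refine exists_isLimitState hw fun A => ?_
  -- Volumes are enlarged by `A` because monotonicity is available only for functions of the spins
  -- inside the smaller volume.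
  have hanti : Antitone fun Λ => gibbs (plusWeight J β) (Λ ∪ A) (spinProd A) := fun Λ Λ' h =>
    plus_gibbs_antitone hJ hβ (Finset.union_subset_union_left h) (spinProd_mem_posCone A)
      ((dependsOn_spinProd A).mono (by simp))
  have hb : BddBelow (Set.range fun Λ => gibbs (plusWeight J β) (Λ ∪ A) (spinProd A)) :=
    ⟨-1, by rintro _ ⟨Λ, rfl⟩; exact (abs_le.1 (abs_gibbs_spinProd_le hw _ _)).1⟩
  refine ⟨_, (tendsto_atTop_ciInf hanti hb).congr' ?_⟩
  filter_upwards [eventually_ge_atTop A] with Λ hΛ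
  rw [Finset.union_eq_left.2 hΛ]

lemma exists_free_limit (hJ : IsFerromagnetic J) (hβ : 0 ≤ β) :
    ∃ μ, IsLimitState (freeWeight J β) μ := by
  classical
  have hw := isVolumeWeight_freeWeight hJ hβ
  refine exists_isLimitState hw fun A => ?_
  have hmono : Monotone fun Λ => gibbs (freeWeight J β) (Λ ∪ A) (spinProd A) := fun Λ Λ' h =>
    free_gibbs_monotone hJ hβ (Finset.union_subset_union_left h) (spinProd_mem_posCone A)
      ((dependsOn_spinProd A).mono (by simp))
  have hb : BddAbove (Set.range fun Λ => gibbs (freeWeight J β) (Λ ∪ A) (spinProd A)) :=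
    ⟨1, by rintro _ ⟨Λ, rfl⟩; exact (abs_le.1 (abs_gibbs_spinProd_le hw _ _)).2⟩
  refine ⟨_, (tendsto_atTop_ciSup hmono hb).congr' ?_⟩
  filter_upwards [eventually_ge_atTop A] with Λ hΛ
  rw [Finset.union_eq_left.2 hΛ]

end InfiniteVolume

/-! ### Mixing on a spanning family -/

section Mixing

variable {d : ℕ}

lemma atInfinity_eq_cofinite : atInfinity d = cofinite := by
  rw [atInfinity, comap_norm_atTop, Metric.cobounded_eq_cocompact, cocompact_eq_cofinite]

lemma neBot_atInfinity (hd : 1 ≤ d) : NeBot (atInfinity d) := by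
  have : Nonempty (Fin d) := ⟨⟨0, hd⟩⟩
  rw [atInfinity_eq_cofinite]
  infer_instance

lemma eventually_disjoint_translateSites (A B : Finset (Site d)) :
    ∀ᶠ x in atInfinity d, Disjoint A (translateSites x B) := by
  classical
  rw [atInfinity_eq_cofinite]
  refine Set.Finite.subset (Finset.finite_toSet (Finset.image₂ (fun a b => a - b) A B)) ?_
  intro x hx
  obtain ⟨a, ha, hb⟩ := Finset.not_disjoint_iff.1 hx
  refine Finset.mem_coe.2 (Finset.mem_image₂.2 ⟨a, ha, a - x, mem_translateSites.1 hb, ?_⟩)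
  abel

lemma isLocal_of_mem_span {𝒟 : Set (Config d → ℝ)} (h𝒟 : ∀ D ∈ 𝒟, IsLocal D) {F : Config d → ℝ}
    (hF : F ∈ Submodule.span ℝ 𝒟) : IsLocal F := by
  induction hF using Submodule.span_induction with
  | mem x hx => exact h𝒟 x hx
  | zero => exact ⟨∅, fun _ _ _ => rfl⟩
  | add x y _ _ hx hy => exact hx.comp₂ hy (· + ·)
  | smul c x _ hx => exact hx.comp₂ hx fun a _ => c * a

lemma IsMixingFor.span {μ : ProbabilityMeasure (Config d)} {𝒟 : Set (Config d → ℝ)}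
    (h𝒟 : ∀ D ∈ 𝒟, IsLocal D) (h : IsMixingFor μ 𝒟) :
    IsMixingFor μ (Submodule.span ℝ 𝒟 : Set (Config d → ℝ)) := by
  have int : ∀ F G : Config d → ℝ, IsLocal F → IsLocal G → ∀ x,
      Integrable (fun σ => F σ * G (shift x σ)) (μ : Measure (Config d)) := fun F G hF hG x =>
    (hF.comp₂ (hG.shift x) (· * ·)).integrable μ
  have step : ∀ F ∈ 𝒟, ∀ G ∈ Submodule.span ℝ 𝒟,
      Tendsto (fun x => ∫ σ, F σ * G (shift x σ) ∂(μ : Measure (Config d))) (atInfinity d)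
        (𝓝 ((∫ σ, F σ ∂(μ : Measure (Config d))) * ∫ σ, G σ ∂(μ : Measure (Config d)))) := by
    intro F hF G hG
    induction hG using Submodule.span_induction with
    | mem y hy => exact h F hF y hy
    | zero => simpa using tendsto_const_nhds
    | add y z hy hz ihy ihz =>
      have hy' := isLocal_of_mem_span h𝒟 hy
      have hz' := isLocal_of_mem_span h𝒟 hz
      simp only [Pi.add_apply, mul_add]
      rw [integral_add (hy'.integrable μ) (hz'.integrable μ), mul_add]
      refine (ihy.add ihz).congr fun x => ?_
      rw [integral_add (int F y (h𝒟 F hF) hy' x) (int F z (h𝒟 F hF) hz' x)]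
    | smul c y _ ihy =>
      simp only [Pi.smul_apply, smul_eq_mul, mul_left_comm _ c, integral_const_mul]
      exact ihy.const_mul c
  intro F hF G hG
  have hG' := isLocal_of_mem_span h𝒟 hG
  induction hF using Submodule.span_induction with
  | mem y hy => exact step y hy G hG
  | zero => simpa using tendsto_const_nhds
  | add y z hy hz ihy ihz =>
    have hy' := isLocal_of_mem_span h𝒟 hy
    have hz' := isLocal_of_mem_span h𝒟 hz
    simp only [Pi.add_apply, add_mul]
    rw [integral_add (hy'.integrable μ) (hz'.integrable μ), add_mul]
    refine (ihy.add ihz).congr fun x => ?_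
    rw [integral_add (int y G hy' hG' x) (int z G hz' hG' x)]
  | smul c y _ ihy =>
    simp only [Pi.smul_apply, smul_eq_mul, mul_assoc, integral_const_mul]
    exact ihy.const_mul c

/-- Mixing from two-sided bounds on the correlations in large volumes. -/
lemma isMixingFor_of_bounds {w : Finset (Site d) → Config d → ℝ} (hw : IsVolumeWeight w)
    {μ : ProbabilityMeasure (Config d)} (hμ : IsLimitState w μ) {𝒟 : Set (Config d → ℝ)}
    (h𝒟 : ∀ D ∈ 𝒟, IsLocal D)
    (lower : ∀ F ∈ 𝒟, ∀ G ∈ 𝒟, ∀ᶠ x in atInfinity d, ∀ᶠ Λ in atTop,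
      gibbs w Λ F * gibbs w Λ (fun σ => G (shift x σ)) ≤ gibbs w Λ fun σ => F σ * G (shift x σ))
    (upper : ∀ F ∈ 𝒟, ∀ G ∈ 𝒟, ∀ᶠ V in atTop, ∀ᶠ x in atInfinity d, ∀ᶠ Λ in atTop,
      gibbs w Λ (fun σ => F σ * G (shift x σ)) ≤ gibbs w Λ F * gibbs w V G) :
    IsMixingFor μ 𝒟 := by
  intro F hF G hG
  have hmul : ∀ x, IsLocal fun σ => F σ * G (shift x σ) := fun x =>
    (h𝒟 F hF).comp₂ ((h𝒟 G hG).shift x) (· * ·)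
  have hinv : ∀ x, ∫ σ, G (shift x σ) ∂(μ : Measure (Config d)) =
      ∫ σ, G σ ∂(μ : Measure (Config d)) := fun x => by
    have hx := hμ.measurePreserving_shift hw x
    conv_rhs => rw [← hx.map_eq]
    exact (integral_map hx.measurable.aemeasurable
      (h𝒟 G hG).continuous.aestronglyMeasurable).symm
  refine tendsto_order.2 ⟨fun a ha => ?_, fun a ha => ?_⟩
  · filter_upwards [lower F hF G hG] with x hx
    refine ha.trans_le ?_
    rw [← hinv x]
    exact le_of_tendsto_of_tendsto ((hμ F (h𝒟 F hF)).mul (hμ _ ((h𝒟 G hG).shift x)))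
      (hμ _ (hmul x)) hx
  · have hlim := (hμ G (h𝒟 G hG)).const_mul (∫ σ, F σ ∂(μ : Measure (Config d)))
    -- `V` is fixed first, with `⟨F⟩⟨G⟩_V < a`; the bound for far `x` then survives the limit in
    -- `Λ`.
    obtain ⟨V, hV, hVa⟩ := ((upper F hF G hG).and (hlim.eventually (gt_mem_nhds ha))).exists
    filter_upwards [hV] with x hx
    exact (le_of_tendsto_of_tendsto (hμ _ (hmul x)) ((hμ F (h𝒟 F hF)).mul_const _) hx).trans_lt hVa

/-! ### The plus state -/

variable {J : Site d → Site d → ℝ} {β : ℝ}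

lemma isLocal_plusProd (A : Finset (Site d)) : IsLocal (plusProd A) := ⟨A, dependsOn_plusProd A⟩

lemma plusProd_shift (x : Site d) (A : Finset (Site d)) (σ : Config d) :
    plusProd A (shift x σ) = plusProd (translateSites x A) σ := by
  simp [plusProd, translateSites, shift, Finset.prod_map]

/-- Expand the product of `σ_x = (1 + σ_x) - 1` over subsets of `A`. -/
lemma spinProd_mem_span_plusProd (A : Finset (Site d)) :
    spinProd A ∈ Submodule.span ℝ (Set.range (plusProd (d := d))) := by
  classical
  have : spinProd A = ∑ B ∈ A.powerset, ((-1) ^ (A \ B).card : ℝ) • plusProd B := by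
    ext σ
    have h : ∀ x ∈ A, spin (σ x) = (1 + spin (σ x)) + (-1) := fun x _ => by ring
    rw [spinProd_apply, Finset.prod_congr rfl h, Finset.prod_add]
    simp [plusProd, mul_comm]
  rw [this]
  exact Submodule.sum_mem _ fun B _ => Submodule.smul_mem _ _ (Submodule.subset_span ⟨B, rfl⟩)

lemma isMixingFor_plusProd (hJ : IsFerromagnetic J) (hβ : 0 ≤ β)
    {μ : ProbabilityMeasure (Config d)} (hμ : IsLimitState (plusWeight J β) μ) :
    IsMixingFor μ (Set.range (plusProd (d := d))) := by
  classical
  have hw := isVolumeWeight_plusWeight hJ hβ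
  refine isMixingFor_of_bounds hw hμ ?_ ?_ ?_
  · rintro _ ⟨A, rfl⟩
    exact isLocal_plusProd A
  · rintro _ ⟨A, rfl⟩ _ ⟨B, rfl⟩
    refine Eventually.of_forall fun x => Eventually.of_forall fun Λ => ?_
    simp only [plusProd_shift]
    exact gibbs_mul_le hw Λ (plusProd_mem_posCone _) (plusProd_mem_posCone _)
  · rintro _ ⟨A, rfl⟩ _ ⟨B, rfl⟩
    filter_upwards [eventually_ge_atTop B] with V hV
    filter_upwards [eventually_disjoint_translateSites A V] with x hx
    filter_upwards [eventually_ge_atTop (A ∪ translateSites x V)] with Λ hΛ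
    have hB : DependsOn (plusProd B) (V : Set (Site d)) :=
      (dependsOn_plusProd B).mono (Finset.coe_subset.2 hV)
    have hAΛ : A ⊆ Λ := Finset.subset_union_left.trans hΛ
    have hA : A ⊆ Λ \ translateSites x V := fun a ha =>
      Finset.mem_sdiff.2 ⟨hAΛ ha, Finset.disjoint_left.1 hx ha⟩
    -- The comparison volume is the translate of `V`, disjoint from `A`; translation covariance
    -- identifies its mean with that in `V`.
    rw [← gibbs_shift hw x hB]
    refine plus_gibbs_le hJ hβ (Finset.subset_union_right.trans hΛ) hA ?_ (hB.shift x)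
    rw [funext (plusProd_shift x B)]
    exact plusProd_mem_posCone _

lemma isMixingFor_plus (hJ : IsFerromagnetic J) (hβ : 0 ≤ β)
    {μ : ProbabilityMeasure (Config d)} (hμ : IsLimitState (plusWeight J β) μ) :
    IsMixingFor μ {F | IsLocal F} := by
  have h := (isMixingFor_plusProd hJ hβ hμ).span fun D hD => by
    obtain ⟨A, rfl⟩ := hD
    exact isLocal_plusProd A
  have hspan : ∀ F : Config d → ℝ, IsLocal F →
      F ∈ Submodule.span ℝ (Set.range (plusProd (d := d))) := fun F hF =>
    Submodule.span_le.2 (Set.range_subset_iff.2 spinProd_mem_span_plusProd) hF.mem_span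
  exact fun F hF G hG => h F (hspan F hF) G (hspan G hG)

/-! ### The free state -/

/-- The factor which removes the bonds in `T` from a Boltzmann weight. -/
noncomputable def removal (J : Site d → Site d → ℝ) (β : ℝ) (T : Finset (Site d × Site d))
    (σ : Config d) : ℝ :=
  (bondWeight J β T σ)⁻¹

lemma exists_subset_product (T : Finset (Site d × Site d)) : ∃ A : Finset (Site d), T ⊆ A ×ˢ A := by
  classical
  refine ⟨T.image Prod.fst ∪ T.image Prod.snd, fun p hp => Finset.mem_product.2 ⟨?_, ?_⟩⟩
  · exact Finset.mem_union_left _ (Finset.mem_image_of_mem _ hp)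
  · exact Finset.mem_union_right _ (Finset.mem_image_of_mem _ hp)

lemma dependsOn_removal {T : Finset (Site d × Site d)} {A : Finset (Site d)} (h : T ⊆ A ×ˢ A) :
    DependsOn (removal J β T) (A : Set (Site d)) := fun _ _ hστ =>
  congrArg Inv.inv (dependsOn_bondWeight h hστ)

lemma isLocal_removal (T : Finset (Site d × Site d)) : IsLocal (removal J β T) :=
  let ⟨A, hA⟩ := exists_subset_product T
  ⟨A, dependsOn_removal hA⟩

lemma removal_shift (hJ : IsFerromagnetic J) (x : Site d) (T : Finset (Site d × Site d))
    (σ : Config d) : removal J β T (shift x σ) = removal J β (translatePairs x T) σ := by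
  rw [removal, removal, bondWeight_shift hJ]

lemma removal_mul_bondWeight [DecidableEq (Site d × Site d)] {S T : Finset (Site d × Site d)}
    (h : T ⊆ S) (σ : Config d) :
    removal J β T σ * bondWeight J β S σ = bondWeight J β (S \ T) σ := by
  conv_lhs => rw [← Finset.sdiff_union_of_subset h, bondWeight_union Finset.sdiff_disjoint]
  rw [removal]
  field_simp [(bondWeight_pos (J := J) (β := β) T σ).ne']

lemma removal_union [DecidableEq (Site d × Site d)] {S T : Finset (Site d × Site d)}
    (h : Disjoint S T) (σ : Config d) :
    removal J β (S ∪ T) σ = removal J β S σ * removal J β T σ := by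
  rw [removal, bondWeight_union h, mul_inv, removal, removal]

/-- The partition function is log-supermodular in the set of bonds. -/
lemma avg_bondWeight_supermodular [DecidableEq (Site d × Site d)] (hJ : IsFerromagnetic J)
    (hβ : 0 ≤ β) (Λ : Finset (Site d)) (S T : Finset (Site d × Site d)) :
    avg Λ (bondWeight J β S) * avg Λ (bondWeight J β T) ≤
      avg Λ (bondWeight J β (S ∪ T)) * avg Λ (bondWeight J β (S ∩ T)) := by
  have e1 : ∀ σ, bondWeight J β S σ = bondWeight J β (S \ T) σ * bondWeight J β (S ∩ T) σ :=
    fun σ => by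
      rw [← bondWeight_union (Finset.disjoint_sdiff_inter S T), Finset.sdiff_union_inter]
  have e2 : ∀ σ, bondWeight J β T σ = bondWeight J β (T \ S) σ * bondWeight J β (S ∩ T) σ :=
    fun σ => by
      rw [Finset.inter_comm, ← bondWeight_union (Finset.disjoint_sdiff_inter T S),
        Finset.sdiff_union_inter]
  have e3 : ∀ σ, bondWeight J β (S ∪ T) σ =
      bondWeight J β (S \ T) σ * bondWeight J β (T \ S) σ * bondWeight J β (S ∩ T) σ := fun σ => by
    rw [mul_assoc, ← e2, ← bondWeight_union Finset.sdiff_disjoint, Finset.sdiff_union_self_eq_union]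
  rw [funext e1, funext e2, funext e3]
  exact avg_griffiths Λ (bondWeight_mem_posCone hJ hβ _) (bondWeight_mem_posCone hJ hβ _)
    (isFerroWeight_bondWeight hJ hβ _)

lemma gibbs_removal [DecidableEq (Site d × Site d)] {Λ : Finset (Site d)}
    {T : Finset (Site d × Site d)} (h : T ⊆ Λ ×ˢ Λ) :
    gibbs (freeWeight J β) Λ (removal J β T) =
      avg Λ (bondWeight J β ((Λ ×ˢ Λ) \ T)) / avg Λ (bondWeight J β (Λ ×ˢ Λ)) := by
  rw [gibbs_apply]
  simp only [freeWeight, removal_mul_bondWeight h]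

lemma gibbs_removal_mul [DecidableEq (Site d × Site d)] {Λ : Finset (Site d)}
    {S T : Finset (Site d × Site d)} (hS : S ⊆ Λ ×ˢ Λ) (hT : T ⊆ Λ ×ˢ Λ) (hST : Disjoint S T) :
    gibbs (freeWeight J β) Λ (fun σ => removal J β S σ * removal J β T σ) =
      avg Λ (bondWeight J β ((Λ ×ˢ Λ) \ (S ∪ T))) / avg Λ (bondWeight J β (Λ ×ˢ Λ)) := by
  rw [← gibbs_removal (Finset.union_subset hS hT)]
  simp only [← removal_union hST]

/-- Supermodularity for the complements of `S` and of `T`: as `S` and `T` are disjoint, the union is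
all of `Λ ×ˢ Λ`. -/
lemma free_lower_bound (hJ : IsFerromagnetic J) (hβ : 0 ≤ β) {Λ : Finset (Site d)}
    {S T : Finset (Site d × Site d)} (hS : S ⊆ Λ ×ˢ Λ) (hT : T ⊆ Λ ×ˢ Λ) (hST : Disjoint S T) :
    gibbs (freeWeight J β) Λ (removal J β S) * gibbs (freeWeight J β) Λ (removal J β T) ≤
      gibbs (freeWeight J β) Λ (fun σ => removal J β S σ * removal J β T σ) := by
  classical
  have hZ : 0 < avg Λ (bondWeight J β (Λ ×ˢ Λ)) := avg_pos Λ (bondWeight_pos _)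
  have key := avg_bondWeight_supermodular hJ hβ Λ ((Λ ×ˢ Λ) \ S) ((Λ ×ˢ Λ) \ T)
  rw [← Finset.sdiff_inter_distrib_right, Finset.disjoint_iff_inter_eq_empty.1 hST, Finset.sdiff_empty,
    ← Finset.sdiff_union_distrib] at key
  rw [gibbs_removal hS, gibbs_removal hT, gibbs_removal_mul hS hT hST, div_mul_div_comm,
    div_le_div_iff₀ (by positivity) hZ]
  nlinarith

/-- Supermodularity for the complement of `S ∪ T` and for `V ×ˢ V`: the union restores the bonds of
`T` but not those of `S`, and the intersection is `V ×ˢ V` without `T`. -/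
lemma free_upper_bound (hJ : IsFerromagnetic J) (hβ : 0 ≤ β) {V Λ : Finset (Site d)} (hV : V ⊆ Λ)
    {S T : Finset (Site d × Site d)} (hS : S ⊆ Λ ×ˢ Λ) (hT : T ⊆ V ×ˢ V)
    (hSV : Disjoint S (V ×ˢ V)) :
    gibbs (freeWeight J β) Λ (fun σ => removal J β S σ * removal J β T σ) ≤
      gibbs (freeWeight J β) Λ (removal J β S) * gibbs (freeWeight J β) V (removal J β T) := by
  classical
  have hVΛ : V ×ˢ V ⊆ Λ ×ˢ Λ := Finset.product_subset_product hV hV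
  have hZ : 0 < avg Λ (bondWeight J β (Λ ×ˢ Λ)) := avg_pos Λ (bondWeight_pos _)
  have hZ' : 0 < avg Λ (bondWeight J β (V ×ˢ V)) := avg_pos Λ (bondWeight_pos _)
  have key := avg_bondWeight_supermodular hJ hβ Λ ((Λ ×ˢ Λ) \ (S ∪ T)) (V ×ˢ V)
  have e1 : (Λ ×ˢ Λ) \ (S ∪ T) ∪ V ×ˢ V = (Λ ×ˢ Λ) \ S := by
    ext p
    have h1 := @hT p
    have h2 := @hVΛ p
    have h3 := fun hp : p ∈ S => Finset.disjoint_left.1 hSV hp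
    simp only [Finset.mem_union, Finset.mem_sdiff]
    tauto
  have e2 : (Λ ×ˢ Λ) \ (S ∪ T) ∩ V ×ˢ V = (V ×ˢ V) \ T := by
    ext p
    have h2 := @hVΛ p
    have h3 := fun hp : p ∈ S => Finset.disjoint_left.1 hSV hp
    simp only [Finset.mem_union, Finset.mem_sdiff, Finset.mem_inter]
    tauto
  rw [e1, e2] at key
  rw [gibbs_of_subset (isVolumeWeight_freeWeight hJ hβ) hV (dependsOn_removal hT),
    gibbs_removal hS, gibbs_removal_mul hS (hT.trans hVΛ) (hSV.mono_right hT), div_mul_div_comm]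
  simp only [freeWeight, removal_mul_bondWeight hT]
  rw [div_le_div_iff₀ hZ (by positivity)]
  have := mul_le_mul_of_nonneg_right key hZ.le
  linarith

lemma translatePairs_mono (x : Site d) {S T : Finset (Site d × Site d)} (h : S ⊆ T) :
    translatePairs x S ⊆ translatePairs x T :=
  Finset.map_subset_map.2 h

lemma disjoint_product {A B : Finset (Site d)} (h : Disjoint A B) :
    Disjoint (A ×ˢ A) (B ×ˢ B) :=
  Finset.disjoint_product.2 (Or.inl h)

lemma isMixingFor_removal (hJ : IsFerromagnetic J) (hβ : 0 ≤ β)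
    {μ : ProbabilityMeasure (Config d)} (hμ : IsLimitState (freeWeight J β) μ) :
    IsMixingFor μ (Set.range (removal J β)) := by
  classical
  have hw := isVolumeWeight_freeWeight hJ hβ
  refine isMixingFor_of_bounds hw hμ ?_ ?_ ?_
  · rintro _ ⟨T, rfl⟩
    exact isLocal_removal T
  · rintro _ ⟨S, rfl⟩ _ ⟨T, rfl⟩
    obtain ⟨A, hA⟩ := exists_subset_product S
    obtain ⟨B, hB⟩ := exists_subset_product T
    filter_upwards [eventually_disjoint_translateSites A B] with x hx
    filter_upwards [eventually_ge_atTop (A ∪ translateSites x B)] with Λ hΛ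
    have hAΛ : A ⊆ Λ := Finset.subset_union_left.trans hΛ
    have hBΛ : translateSites x B ⊆ Λ := Finset.subset_union_right.trans hΛ
    have hTB : translatePairs x T ⊆ translateSites x B ×ˢ translateSites x B :=
      translatePairs_product x B ▸ translatePairs_mono x hB
    simp only [removal_shift hJ]
    exact free_lower_bound hJ hβ (hA.trans (Finset.product_subset_product hAΛ hAΛ))
      (hTB.trans (Finset.product_subset_product hBΛ hBΛ)) ((disjoint_product hx).mono hA hTB)
  · rintro _ ⟨S, rfl⟩ _ ⟨T, rfl⟩
    obtain ⟨A, hA⟩ := exists_subset_product S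
    obtain ⟨B, hB⟩ := exists_subset_product T
    filter_upwards [eventually_ge_atTop B] with V hV
    filter_upwards [eventually_disjoint_translateSites A V] with x hx
    filter_upwards [eventually_ge_atTop (A ∪ translateSites x V)] with Λ hΛ
    have hAΛ : A ⊆ Λ := Finset.subset_union_left.trans hΛ
    have hTV : T ⊆ V ×ˢ V := hB.trans (Finset.product_subset_product hV hV)
    rw [← gibbs_shift hw x (dependsOn_removal hTV)]
    simp only [removal_shift hJ]
    exact free_upper_bound hJ hβ (Finset.subset_union_right.trans hΛ)
      (hA.trans (Finset.product_subset_product hAΛ hAΛ))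
      (translatePairs_product x V ▸ translatePairs_mono x hTV)
      ((disjoint_product hx).mono_left hA)

end Mixing

/-! ### Even local functions and bond removals -/

section FreeSpan

variable {d : ℕ} {J : Site d → Site d → ℝ} {β : ℝ}

lemma mul_spin_mem_span_removal_of_coupling_pos {p : Site d × Site d} (hp : 0 < coupling J β p)
    {f : Config d → ℝ} (hf : f ∈ Submodule.span ℝ (Set.range (removal J β))) :
    (fun σ => spin (pairChar p σ) * f σ) ∈ Submodule.span ℝ (Set.range (removal J β)) := by
  classical
  set V := Submodule.span ℝ (Set.range (removal J β)) with hV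
  have hmem : ∀ T, removal J β T ∈ V := fun T => Submodule.subset_span ⟨T, rfl⟩
  set k := coupling J β p
  have hs : 0 < Real.sinh k := Real.sinh_pos_iff.2 hp
  have hinsert : ∀ T, p ∉ T → ∀ σ, removal J β (insert p T) σ =
      (Real.cosh k - Real.sinh k * spin (pairChar p σ)) * removal J β T σ := fun T hT σ => by
    have h1 : bondWeight J β {p} σ = Real.exp (k * spin (pairChar p σ)) := by
      rw [bondWeight, Finset.sum_singleton]
    rw [Finset.insert_eq, removal_union (Finset.disjoint_singleton_left.2 hT), removal, h1,
      ← Real.exp_neg, ← neg_mul, exp_mul_spin, Real.cosh_neg, Real.sinh_neg, neg_mul,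
      ← sub_eq_add_neg]
  -- Removing one more bond multiplies by `cosh k - sinh k σ_p`, which can be solved for `σ_p`
  -- because `sinh k > 0`.
  have hout : ∀ T, p ∉ T → (fun σ => spin (pairChar p σ) * removal J β T σ) ∈ V := fun T hT => by
    convert V.smul_mem (Real.sinh k)⁻¹
      (sub_mem (V.smul_mem (Real.cosh k) (hmem T)) (hmem (insert p T))) using 1
    ext σ
    simp only [Pi.smul_apply, Pi.sub_apply, smul_eq_mul, hinsert T hT]
    field_simp
    ring
  have hLe : V ≤ V.comap (LinearMap.mulLeft ℝ fun σ => spin (pairChar p σ)) := by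
    refine Submodule.span_le.2 ?_
    rintro _ ⟨T, rfl⟩
    change (fun σ => spin (pairChar p σ) * removal J β T σ) ∈ V
    -- If `p` is already removed, `σ_p² = 1` gives `σ_p (cosh k - sinh k σ_p) = cosh k σ_p - sinh
    -- k`.
    by_cases hT : p ∈ T
    · have hT' := Finset.notMem_erase p T
      convert sub_mem (V.smul_mem (Real.cosh k) (hout _ hT'))
        (V.smul_mem (Real.sinh k) (hmem (T.erase p))) using 1
      ext σ
      rw [← Finset.insert_erase hT, hinsert _ hT', Finset.erase_insert hT']
      simp only [Pi.smul_apply, Pi.sub_apply, smul_eq_mul]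
      linear_combination (-Real.sinh k * removal J β (T.erase p) σ) * spin_mul_self (pairChar p σ)
    · exact hout T hT
  exact hLe hf

lemma mul_spin_mem_span_removal (hJ : IsFerromagnetic J) (hβ : 0 < β) (x : Site d)
    {f : Config d → ℝ} (hf : f ∈ Submodule.span ℝ (Set.range (removal J β))) :
    (fun σ => spin (σ 0) * spin (σ x) * f σ) ∈ Submodule.span ℝ (Set.range (removal J β)) := by
  obtain ⟨m, p, hp0, rfl, hpos⟩ := hJ.aperiodic x
  have hstep : ∀ i < m, 0 < J (p i) (p (i + 1)) := fun i hi =>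
    (hJ.nonneg _ _).lt_of_ne' (Finset.prod_ne_zero_iff.1 hpos.ne' i (Finset.mem_range.2 hi))
  have key : ∀ i ≤ m, (fun σ => spin (σ 0) * spin (σ (p i)) * f σ) ∈
      Submodule.span ℝ (Set.range (removal J β)) := by
    intro i
    induction i with
    | zero =>
      intro _
      simpa [hp0, spin_mul_self] using hf
    | succ i ih =>
      intro hi
      have hprev := ih (by omega)
      -- The path may stay at a site where `J x x > 0`. Such a step carries no coupling, but the end
      -- point does not move either.
      by_cases heq : p i = p (i + 1)
      · rwa [← heq]
      · have hc : 0 < coupling J β (p i, p (i + 1)) := by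
          rw [coupling, if_pos heq]
          exact mul_pos (by positivity) (hstep i hi)
        convert mul_spin_mem_span_removal_of_coupling_pos hc hprev using 1
        ext σ
        rw [spin_pairChar]
        linear_combination (-spin (σ 0) * spin (σ (p (i + 1))) * f σ) * spin_mul_self (σ (p i))
  exact key m le_rfl

/-- `σ_A` is the product of `σ_0 σ_x` over `x ∈ A`, since `σ_0` occurs an even number of times. -/
lemma spinProd_mem_span_removal (hJ : IsFerromagnetic J) (hβ : 0 < β) {A : Finset (Site d)}
    (hA : Even A.card) : spinProd A ∈ Submodule.span ℝ (Set.range (removal J β)) := by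
  classical
  have key : ∀ B : Finset (Site d), (fun σ : Config d => ∏ x ∈ B, (spin (σ 0) * spin (σ x))) ∈
      Submodule.span ℝ (Set.range (removal J β)) := by
    intro B
    induction B using Finset.induction_on with
    | empty =>
      refine Submodule.subset_span ⟨∅, ?_⟩
      ext σ
      simp [removal, bondWeight]
    | insert a B ha ih =>
      simp only [Finset.prod_insert ha]
      exact mul_spin_mem_span_removal hJ hβ a ih
  convert key A using 1
  ext σ
  obtain ⟨n, hn⟩ := hA
  rw [Finset.prod_mul_distrib, Finset.prod_const, hn, pow_add, ← mul_pow, spin_mul_self, one_pow,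
    one_mul, spinProd_apply]

lemma even_local_mem_span_removal (hJ : IsFerromagnetic J) (hβ : 0 < β) {F : Config d → ℝ}
    (hF : IsLocal F) (heven : IsEven F) :
    F ∈ Submodule.span ℝ (Set.range (removal J β)) := by
  set V := Submodule.span ℝ (Set.range (removal J β)) with hV
  -- The projection onto even functions fixes even characters, kills odd ones, and leaves `F`
  -- unchanged.
  let Φ : (Config d → ℝ) →ₗ[ℝ] (Config d → ℝ) :=
    (1 / 2 : ℝ) • (LinearMap.id + LinearMap.funLeft ℝ ℝ (fun σ : Config d => -σ))
  have hΦ : ∀ f σ, Φ f σ = 1 / 2 * (f σ + f (-σ)) := fun f σ => rfl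
  have hle : Submodule.span ℝ (Set.range (spinProd (d := d))) ≤ V.comap Φ := by
    refine Submodule.span_le.2 ?_
    rintro _ ⟨A, rfl⟩
    change Φ (spinProd A) ∈ V
    rcases Nat.even_or_odd A.card with h | h
    · convert spinProd_mem_span_removal hJ hβ h using 1
      ext σ
      rw [hΦ, spinProd_neg, h.neg_one_pow]
      ring
    · convert V.zero_mem using 1
      ext σ
      rw [hΦ, spinProd_neg, h.neg_one_pow, Pi.zero_apply]
      ring
  have := hle hF.mem_span
  convert Submodule.mem_comap.1 this using 1
  ext σ
  rw [hΦ, heven]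
  ring

lemma freeWeight_eq_plusWeight_of_zero : freeWeight J 0 = plusWeight J 0 := by
  ext Λ σ
  simp [plusWeight]

lemma isMixingFor_free (hJ : IsFerromagnetic J) (hβ : 0 ≤ β)
    {μ : ProbabilityMeasure (Config d)} (hμ : IsLimitState (freeWeight J β) μ) :
    IsMixingFor μ {F | IsLocal F ∧ IsEven F} := by
  -- At `β = 0` removals are constant and span too little, but the free and plus weights coincide
  -- and the plus case applies.
  rcases hβ.eq_or_lt with rfl | hβ'
  · rw [freeWeight_eq_plusWeight_of_zero] at hμ
    have := isMixingFor_plus hJ hβ hμ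
    exact fun F hF G hG => this F hF.1 G hG.1
  · have h := (isMixingFor_removal hJ hβ hμ).span fun D hD => by
      obtain ⟨T, rfl⟩ := hD
      exact isLocal_removal T
    exact fun F hF G hG => h F (even_local_mem_span_removal hJ hβ' hF.1 hF.2) G
      (even_local_mem_span_removal hJ hβ' hG.1 hG.2)

end FreeSpan

/-! ### Mixing on events and ergodicity -/

section Events

variable {d : ℕ}

lemma abs_integral_mul_sub_le {Ω : Type*} [MeasurableSpace Ω] {μ : Measure Ω}
    [IsProbabilityMeasure μ] {f g F G : Ω → ℝ} (hf : Integrable f μ) (hg : Integrable g μ)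
    (hF : Integrable F μ) (hG : Integrable G μ) (hg1 : ∀ σ, |g σ| ≤ 1) (hF1 : ∀ σ, |F σ| ≤ 1) :
    |∫ σ, f σ * g σ ∂μ - ∫ σ, F σ * G σ ∂μ| ≤ ∫ σ, |f σ - F σ| ∂μ + ∫ σ, |g σ - G σ| ∂μ := by
  have h1 : Integrable (fun σ => f σ * g σ) μ :=
    hf.mul_bdd hg.aestronglyMeasurable (Eventually.of_forall hg1)
  have h2 : Integrable (fun σ => F σ * G σ) μ :=
    hG.bdd_mul hF.aestronglyMeasurable (Eventually.of_forall hF1)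
  have h3 : Integrable (fun σ => |f σ - F σ|) μ := (hf.sub hF).abs
  have h4 : Integrable (fun σ => |g σ - G σ|) μ := (hg.sub hG).abs
  rw [← integral_sub h1 h2, ← integral_add h3 h4]
  refine abs_integral_le_integral_abs.trans
    (integral_mono (h1.sub h2).abs (h3.add h4) fun σ => ?_)
  calc |f σ * g σ - F σ * G σ| = |(f σ - F σ) * g σ + F σ * (g σ - G σ)| := by ring_nf
    _ ≤ |f σ - F σ| * |g σ| + |F σ| * |g σ - G σ| := by
      rw [← abs_mul, ← abs_mul]
      exact abs_add_le _ _
    _ ≤ |f σ - F σ| + |g σ - G σ| :=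
      add_le_add (mul_le_of_le_one_right (abs_nonneg _) (hg1 σ))
        (mul_le_of_le_one_left (abs_nonneg _) (hF1 σ))

lemma abs_mul_integral_sub_le {Ω : Type*} [MeasurableSpace Ω] {μ : Measure Ω}
    [IsProbabilityMeasure μ] {f g F G : Ω → ℝ} (hf : Integrable f μ) (hg : Integrable g μ)
    (hF : Integrable F μ) (hG : Integrable G μ) (hg1 : ∀ σ, |g σ| ≤ 1) (hF1 : ∀ σ, |F σ| ≤ 1) :
    |(∫ σ, f σ ∂μ) * ∫ σ, g σ ∂μ - (∫ σ, F σ ∂μ) * ∫ σ, G σ ∂μ| ≤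
      ∫ σ, |f σ - F σ| ∂μ + ∫ σ, |g σ - G σ| ∂μ := by
  have bound : ∀ {h : Ω → ℝ}, Integrable h μ → (∀ σ, |h σ| ≤ 1) → |∫ σ, h σ ∂μ| ≤ 1 :=
    fun {h} hh h1 => abs_integral_le_integral_abs.trans
      ((integral_mono hh.abs (integrable_const 1) h1).trans_eq (by simp))
  have e : (∫ σ, f σ ∂μ) * ∫ σ, g σ ∂μ - (∫ σ, F σ ∂μ) * ∫ σ, G σ ∂μ =
      (∫ σ, (f σ - F σ) ∂μ) * ∫ σ, g σ ∂μ + (∫ σ, F σ ∂μ) * ∫ σ, (g σ - G σ) ∂μ := by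
    rw [integral_sub hf hF, integral_sub hg hG]
    ring
  rw [e]
  refine (abs_add_le _ _).trans ?_
  rw [abs_mul, abs_mul]
  exact add_le_add
    ((mul_le_of_le_one_right (abs_nonneg _) (bound hg hg1)).trans abs_integral_le_integral_abs)
    ((mul_le_of_le_one_left (abs_nonneg _) (bound hF hF1)).trans abs_integral_le_integral_abs)

lemma abs_indicator_one_le {Ω : Type*} (A : Set Ω) (σ : Ω) :
    |A.indicator (fun _ => (1 : ℝ)) σ| ≤ 1 := by
  by_cases h : σ ∈ A <;> simp [h]

/-- Mixing on events follows from mixing for functions which approximate their indicators. -/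
lemma isMixingOn_of_approx {μ : ProbabilityMeasure (Config d)} {C : Set (Config d → ℝ)}
    {𝒜 : Set (Set (Config d))}
    (hinv : ∀ x : Site d, MeasurePreserving (shift x) (μ : Measure (Config d)) μ)
    (hmix : IsMixingFor μ C) (hmeas : ∀ A ∈ 𝒜, MeasurableSet A)
    (happrox : ∀ A ∈ 𝒜, ∀ ε > 0, ∃ F ∈ C, IsLocal F ∧ (∀ σ, |F σ| ≤ 1) ∧
      ∫ σ, |A.indicator (fun _ => (1 : ℝ)) σ - F σ| ∂(μ : Measure (Config d)) ≤ ε) :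
    IsMixingOn μ 𝒜 := by
  intro A hA B hB
  have hAm := hmeas A hA
  have hBm := hmeas B hB
  rw [← ENNReal.tendsto_toReal_iff (fun _ => measure_ne_top _ _)
    (ENNReal.mul_ne_top (measure_ne_top _ _) (measure_ne_top _ _)), ENNReal.toReal_mul]
  set f := A.indicator fun _ => (1 : ℝ) with hf
  set g := B.indicator fun _ => (1 : ℝ) with hg
  have hfi : Integrable f (μ : Measure (Config d)) := (integrable_const 1).indicator hAm
  have hgi : Integrable g (μ : Measure (Config d)) := (integrable_const 1).indicator hBm
  have e1 : ((μ : Measure (Config d)) A).toReal = ∫ σ, f σ ∂(μ : Measure (Config d)) :=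
    (integral_indicator_one hAm).symm
  have e2 : ((μ : Measure (Config d)) B).toReal = ∫ σ, g σ ∂(μ : Measure (Config d)) :=
    (integral_indicator_one hBm).symm
  have e3 : ∀ x, ((μ : Measure (Config d)) (A ∩ shift x ⁻¹' B)).toReal =
      ∫ σ, f σ * g (shift x σ) ∂(μ : Measure (Config d)) := fun x => by
    refine (integral_indicator_one (hAm.inter ((measurable_shift x) hBm))).symm.trans ?_
    congr 1
    ext σ
    by_cases h1 : σ ∈ A <;> by_cases h2 : shift x σ ∈ B <;> simp [hf, hg, h1, h2]
  simp only [e1, e2, e3]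
  refine Metric.tendsto_nhds.2 fun ε hε => ?_
  -- The two replacements, in the correlation and in the product of means, cost `ε / 4` each; mixing
  -- for `F` and `G` contributes the remaining `ε / 2`.
  obtain ⟨F, hFC, hFl, hF1, hFε⟩ := happrox A hA (ε / 8) (by positivity)
  obtain ⟨G, hGC, hGl, hG1, hGε⟩ := happrox B hB (ε / 8) (by positivity)
  have hFi := hFl.integrable μ
  have hGi := hGl.integrable μ
  filter_upwards [Metric.tendsto_nhds.1 (hmix F hFC G hGC) (ε / 2) (by positivity)] with x hx
  -- Invariance of `μ` makes the error of replacing the translated `g` uniform in `x`.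
  have hshift : ∫ σ, |g (shift x σ) - G (shift x σ)| ∂(μ : Measure (Config d)) =
      ∫ σ, |g σ - G σ| ∂(μ : Measure (Config d)) := by
    conv_rhs => rw [← (hinv x).map_eq]
    refine (integral_map (f := fun σ => |g σ - G σ|)
      (measurable_shift x).aemeasurable ?_).symm
    rw [(hinv x).map_eq]
    exact (hgi.sub hGi).abs.aestronglyMeasurable
  have h1 := abs_integral_mul_sub_le hfi ((hinv x).integrable_comp_of_integrable hgi) hFi
    ((hinv x).integrable_comp_of_integrable hGi) (fun σ => abs_indicator_one_le B (shift x σ)) hF1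
  have h2 := abs_mul_integral_sub_le hfi hgi hFi hGi (abs_indicator_one_le B) hF1
  simp only [Function.comp_apply, hshift] at h1
  rw [Real.dist_eq] at hx ⊢
  rw [abs_lt] at hx ⊢
  rw [abs_le] at h1 h2
  constructor <;> linarith [hx.1, hx.2, h1.1, h1.2, h2.1, h2.2]

/-- Cylinders form a ring generating the σ-algebra, so they approximate `A` in measure; their
indicators are local. -/
lemma exists_isLocal_approx (μ : ProbabilityMeasure (Config d)) {A : Set (Config d)}
    (hA : MeasurableSet A) {ε : ℝ} (hε : 0 < ε) :
    ∃ F, IsLocal F ∧ (∀ σ, |F σ| ≤ 1) ∧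
      ∫ σ, |A.indicator (fun _ => (1 : ℝ)) σ - F σ| ∂(μ : Measure (Config d)) ≤ ε := by
  have huniv : {Set.univ} ⊆ measurableCylinders fun _ : Site d => ℤˣ :=
    Set.singleton_subset_iff.2 (univ_mem_measurableCylinders _)
  obtain ⟨t, ht, htA⟩ := exists_measure_symmDiff_lt_of_generateFrom_isSetRing
    (μ := (μ : Measure (Config d))) isSetRing_measurableCylinders
    ⟨{Set.univ}, Set.countable_singleton _, huniv, by simp⟩
    generateFrom_measurableCylinders.symm hA (ENNReal.ofReal_pos.2 hε)
  obtain ⟨B, S, hS, rfl⟩ := (mem_measurableCylinders _).1 ht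
  refine ⟨_, isLocal_indicator_cylinder S, abs_indicator_one_le _, ?_⟩
  have hm : MeasurableSet (symmDiff (cylinder B S) A) := (hS.cylinder B).symmDiff hA
  have e : ∀ σ, |A.indicator (fun _ => (1 : ℝ)) σ - (cylinder B S).indicator (fun _ => 1) σ| =
      (symmDiff (cylinder B S) A).indicator 1 σ := fun σ => by
    by_cases h1 : σ ∈ A <;> by_cases h2 : σ ∈ cylinder B S <;>
      simp [h1, h2, Set.mem_symmDiff, -mem_cylinder]
  simp only [e]
  rw [integral_indicator_one hm]
  exact ENNReal.toReal_le_of_le_ofReal hε.le htA.le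

/-- A local approximation is averaged with its flip. As `A` and `μ` are flip invariant, both halves
have the same `L¹` error. -/
lemma exists_even_isLocal_approx {μ : ProbabilityMeasure (Config d)}
    (hneg : MeasurePreserving (fun σ : Config d => -σ) (μ : Measure (Config d)) μ)
    {A : Set (Config d)} (hA : A ∈ evenEvents d) {ε : ℝ} (hε : 0 < ε) :
    ∃ F, (IsLocal F ∧ IsEven F) ∧ (∀ σ, |F σ| ≤ 1) ∧
      ∫ σ, |A.indicator (fun _ => (1 : ℝ)) σ - F σ| ∂(μ : Measure (Config d)) ≤ ε := by
  obtain ⟨hAm, hAeven⟩ := MeasurableSpace.measurableSet_invariants.1 hA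
  obtain ⟨F, hF, hF1, hFε⟩ := exists_isLocal_approx μ hAm hε
  have hlocal : IsLocal fun σ => F (-σ) :=
    let ⟨B, hB⟩ := hF
    ⟨B, fun σ τ h => hB fun x hx => by simp [h x hx]⟩
  set f := A.indicator fun _ => (1 : ℝ) with hf
  have hfeven : ∀ σ, f (-σ) = f σ := fun σ => by
    have : -σ ∈ A ↔ σ ∈ A := Set.ext_iff.1 hAeven σ
    by_cases h : σ ∈ A
    · simp [hf, h, this.2 h]
    · simp [hf, h, mt this.1 h]
  have hfi : Integrable (fun σ => |f σ - F σ|) (μ : Measure (Config d)) :=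
    (((integrable_const 1).indicator hAm).sub (hF.integrable μ)).abs
  have hint : ∫ σ, |f (-σ) - F (-σ)| ∂(μ : Measure (Config d)) =
      ∫ σ, |f σ - F σ| ∂(μ : Measure (Config d)) := by
    conv_rhs => rw [← hneg.map_eq]
    refine (integral_map (f := fun σ => |f σ - F σ|)
      measurable_neg_config.aemeasurable ?_).symm
    rw [hneg.map_eq]
    exact hfi.aestronglyMeasurable
  have hfi' : Integrable (fun σ => |f (-σ) - F (-σ)|) (μ : Measure (Config d)) :=
    hneg.integrable_comp_of_integrable hfi
  have hG : IsLocal fun σ => 1 / 2 * (F σ + F (-σ)) := hF.comp₂ hlocal fun a b => 1 / 2 * (a + b)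
  refine ⟨fun σ => 1 / 2 * (F σ + F (-σ)), ⟨hG, fun σ => ?_⟩, fun σ => ?_, ?_⟩
  · simp only [neg_neg]
    ring
  · have h1 := abs_le.1 (hF1 σ)
    have h2 := abs_le.1 (hF1 (-σ))
    exact abs_le.2 ⟨by linarith [h1.1, h2.1], by linarith [h1.2, h2.2]⟩
  · calc ∫ σ, |f σ - 1 / 2 * (F σ + F (-σ))| ∂(μ : Measure (Config d))
        ≤ ∫ σ, 1 / 2 * (|f σ - F σ| + |f (-σ) - F (-σ)|) ∂(μ : Measure (Config d)) := by
          refine integral_mono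
            (((integrable_const 1).indicator hAm).sub (hG.integrable μ)).abs
            ((hfi.add hfi').const_mul _) fun σ => ?_
          simp only [hfeven]
          have h := abs_add_le (f σ - F σ) (f σ - F (-σ))
          rw [show f σ - 1 / 2 * (F σ + F (-σ)) =
            1 / 2 * ((f σ - F σ) + (f σ - F (-σ))) by ring, abs_mul,
            abs_of_pos (by norm_num : (0 : ℝ) < 1 / 2)]
          exact mul_le_mul_of_nonneg_left h (by norm_num)
      _ = ∫ σ, |f σ - F σ| ∂(μ : Measure (Config d)) := by
          rw [integral_const_mul, integral_add hfi hfi', hint]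
          ring
      _ ≤ ε := hFε

/-- For invariant `A` the correlation is constantly `μ A`, so `μ A = μ A * μ A`. The assumption `1 ≤
d` makes the filter at infinity nontrivial. -/
lemma IsMixingOn.isErgodicOn (hd : 1 ≤ d) {μ : ProbabilityMeasure (Config d)}
    {𝒜 : Set (Set (Config d))}
    (hinv : ∀ x : Site d, MeasurePreserving (shift x) (μ : Measure (Config d)) μ)
    (h : IsMixingOn μ 𝒜) : IsErgodicOn μ 𝒜 := by
  refine ⟨hinv, fun A hA hAinv => ?_⟩
  have := neBot_atInfinity hd
  have hlim := h A hA A hA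
  simp only [hAinv, Set.inter_self] at hlim
  have heq := tendsto_nhds_unique tendsto_const_nhds hlim
  by_cases h0 : (μ : Measure (Config d)) A = 0
  · exact Or.inl h0
  · exact Or.inr ((ENNReal.mul_eq_left h0 (measure_ne_top _ _)).1 heq.symm)

end Events

/-! ### The theorem on the plus and free states -/

theorem propositionA1 (d : ℕ) (hd : 1 ≤ d) (J : Site d → Site d → ℝ) (hJ : IsFerromagnetic J)
    (β : ℝ) (hβ : 0 ≤ β) :
    ((∃! μ : ProbabilityMeasure (Config d), IsPlusState J β μ) ∧
      ∀ μ : ProbabilityMeasure (Config d), IsPlusState J β μ →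
        IsMixingFor μ {F | IsLocal F} ∧
        IsMixingOn μ {A | MeasurableSet A} ∧
        IsErgodicOn μ {A | MeasurableSet A}) ∧
    ((∃! μ : ProbabilityMeasure (Config d), IsFreeState J β μ) ∧
      ∀ μ : ProbabilityMeasure (Config d), IsFreeState J β μ →
        IsMixingFor μ {F | IsLocal F ∧ IsEven F} ∧
        IsMixingOn μ (evenEvents d) ∧
        IsErgodicOn μ (evenEvents d)) := by
  simp only [isPlusState_iff hJ, isFreeState_iff]
  refine ⟨⟨?_, fun μ hμ => ?_⟩, ?_, fun μ hμ => ?_⟩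
  · obtain ⟨μ, hμ⟩ := exists_plus_limit hJ hβ
    exact ⟨μ, hμ, fun ν hν => hν.unique hμ⟩
  · have hinv := hμ.measurePreserving_shift (isVolumeWeight_plusWeight hJ hβ)
    have hmix := isMixingFor_plus hJ hβ hμ
    have hon : IsMixingOn μ {A | MeasurableSet A} :=
      isMixingOn_of_approx hinv hmix (fun A hA => hA) fun A hA ε hε => by
        obtain ⟨F, hF, h⟩ := exists_isLocal_approx μ hA hε
        exact ⟨F, hF, hF, h⟩
    exact ⟨hmix, hon, hon.isErgodicOn hd hinv⟩
  · obtain ⟨μ, hμ⟩ := exists_free_limit hJ hβ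
    exact ⟨μ, hμ, fun ν hν => hν.unique hμ⟩
  · have hw := isVolumeWeight_freeWeight hJ hβ
    have hinv := hμ.measurePreserving_shift hw
    have hmix := isMixingFor_free hJ hβ hμ
    have hon : IsMixingOn μ (evenEvents d) :=
      isMixingOn_of_approx hinv hmix (fun A hA => (MeasurableSpace.measurableSet_invariants.1 hA).1)
        fun A hA ε hε => by
          obtain ⟨F, hF, h⟩ :=
            exists_even_isLocal_approx (hμ.measurePreserving_neg hw freeWeight_neg) hA hε
          exact ⟨F, hF, hF.1, h⟩
    exact ⟨hmix, hon, hon.isErgodicOn hd hinv⟩
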